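/- Let $dA$ be Lebesgue area measure on $\mathbb{C}$, let $m\ge 0$ be an integer, $1\le p<\infty$ and $r>0$. For measurable $f:\mathbb{C}\to\mathbb{C}$ put $\|f\|_p=\bigl\{\frac{p}{2\pi}\int_{\mathbb{C}}|f(v)|^pe^{-\frac p2|v|^2}dA(v)\bigr\}^{1/p}$. The Fock–Sobolev space $\mathscr{F}^{p,m}$ is the space of entire functions $f$ with $\sum_{k=0}^m\|f^{(k)}\|_p<\infty$. Let $L^{p,m}$ be the space of Lebesgue measurable functions $f$ on $\mathbb{C}$ with $f(v)|v|^me^{-\frac12|v|^2}\in L^p(\mathbb{C},dA)$. Both spaces are normed by $$\|f\|_{p,m}=\Bigl\{\omega_{p,m}\int_{\mathbb{C}}|f(v)|^p|v|^{mp}e^{-\frac p2|v|^2}dA(v)\Bigr\}^{1/p},\qquad \omega_{p,m}=\Bigl(\frac p2\Bigr)^{\frac{mp}2+1}\frac1{\pi\,\Gamma(\frac{mp}2+1)}.$$ Let $K_z^m(v)=\sum_{k=0}^\infty\frac{m!}{(k+m)!}(\bar z v)^k$ and $$P^mh(z)=\frac1{\pi\, m!}\int_{\mathbb{C}}h(v)\overline{K_z^m(v)}\,|v|^{2m}e^{-|v|^2}dA(v).$$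 For a symbol $g$ and $f\in\mathscr{F}^{p,m}$, the Hankel operator is $H_g^pf=(I-P^m)(gf)=gf-P^m(gf)$. Let $\mathcal{BMO}_r^p$ be the set of functions $g:\mathbb{C}\to\mathbb{C}$ that are $p$-integrable on every compact set and satisfy $$\sup_{z\in\mathbb{C}}\Bigl\{\frac1{\pi r^2}\int_{|v-z|\le r}|g(v)-\tilde g_r(z)|^p\,dA(v)\Bigr\}^{1/p}<\infty,\qquad \tilde g_r(z)=\frac1{\pi r^2}\int_{|v-z|\le r}g(v)\,dA(v).$$ **Theorem.** If $g\in\mathcal{BMO}_r^p$, then the Hankel operators $H_g^p$ and $H_{\bar g}^p$ are bounded from $\mathscr{F}^{p,m}$ to $L^{p,m}$. That is, for $u=g$ and for $u=\bar g$: for every $f\in\mathscr{F}^{p,m}$ the integral defining $P^m(uf)(z)$ converges absolutely for every $z\in\mathbb{C}$, the function $H_u^pf$ lies in $L^{p,m}$, and there is a constant $C$ independent of $f$ such that $\|H_u^pf\|_{p,m}\le C\|f\|_{p,m}$ for all $f\in\mathscr{F}^{p,m}$. -/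

import Mathlib

open MeasureTheory
open scoped ENNReal NNReal

namespace FockSobolev

noncomputable section

/-- The norm `‖f‖_p = { (p / 2π) ∫ |f(v)|^p e^{-p|v|²/2} dA(v) }^{1/p}` of the Fock space `F^p`,
as an extended nonnegative number. -/
def fockNorm (p : ℝ) (f : ℂ → ℂ) : ℝ≥0∞ :=
  (ENNReal.ofReal (p / (2 * Real.pi)) *
    ∫⁻ v : ℂ, ‖f v‖ₑ ^ p * ENNReal.ofReal (Real.exp (-(p / 2) * ‖v‖ ^ 2))) ^ (1 / p)

/-- The Fock-Sobolev space `F^{p,m}`: the entire functions `f` such that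
`∑_{0 ≤ k ≤ m} ‖f^{(k)}‖_p < ∞`. -/
def fockSobolev (p : ℝ) (m : ℕ) : Set (ℂ → ℂ) :=
  {f | Differentiable ℂ f ∧ ∑ k ∈ Finset.range (m + 1), fockNorm p (iteratedDeriv k f) < ∞}

/-- The normalizing constant `ω_{p,m} = (p/2)^{mp/2 + 1} / (π Γ(mp/2 + 1))`. -/
def omega (p : ℝ) (m : ℕ) : ℝ :=
  (p / 2) ^ ((m : ℝ) * p / 2 + 1) / (Real.pi * Real.Gamma ((m : ℝ) * p / 2 + 1))

/-- The norm `‖f‖_{p,m} = { ω_{p,m} ∫ |f(v)|^p |v|^{mp} e^{-p|v|²/2} dA(v) }^{1/p}` of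
`F^{p,m}` and `L^{p,m}`, as an extended nonnegative number. -/
def normPM (p : ℝ) (m : ℕ) (f : ℂ → ℂ) : ℝ≥0∞ :=
  (ENNReal.ofReal (omega p m) *
    ∫⁻ v : ℂ, ‖f v‖ₑ ^ p *
      ENNReal.ofReal (‖v‖ ^ ((m : ℝ) * p) * Real.exp (-(p / 2) * ‖v‖ ^ 2))) ^ (1 / p)

/-- The space `L^{p,m}`: the Lebesgue measurable functions `f` such that
`v ↦ f(v) |v|^m e^{-|v|²/2}` belongs to `L^p(ℂ, dA)`. -/
def lebesguePM (p : ℝ) (m : ℕ) : Set (ℂ → ℂ) :=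
  {f | AEStronglyMeasurable f ∧
    MemLp (fun v : ℂ => f v * ((‖v‖ ^ m * Real.exp (-‖v‖ ^ 2 / 2) : ℝ) : ℂ))
      (ENNReal.ofReal p) volume}

/-- The reproducing kernel `K_z^m(v) = ∑_{k ≥ 0} m! / (k + m)! (z̄ v)^k`. -/
def kernel (m : ℕ) (z v : ℂ) : ℂ :=
  ∑' k : ℕ, ((m.factorial : ℂ) / ((k + m).factorial : ℂ)) * (starRingEnd ℂ z * v) ^ k

/-- The integrand `h(v) conj(K_z^m(v)) |v|^{2m} e^{-|v|²}` of the projection `P^m` at `z`. -/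
def projIntegrand (m : ℕ) (h : ℂ → ℂ) (z v : ℂ) : ℂ :=
  h v * starRingEnd ℂ (kernel m z v) * ((‖v‖ ^ (2 * m) * Real.exp (-‖v‖ ^ 2) : ℝ) : ℂ)

/-- The projection `P^m h(z) = (1 / (π m!)) ∫ h(v) conj(K_z^m(v)) |v|^{2m} e^{-|v|²} dA(v)`.
The factor `1 / m!` is the one for which `K_z^m` reproduces, that is, `P^m f = f` on
holomorphic polynomials. -/
def proj (m : ℕ) (h : ℂ → ℂ) (z : ℂ) : ℂ :=
  (1 / ((Real.pi : ℂ) * (m.factorial : ℂ))) * ∫ v : ℂ, projIntegrand m h z v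

/-- The Hankel operator `H_g f = (I - P^m)(g f)`. -/
def hankel (m : ℕ) (g f : ℂ → ℂ) (z : ℂ) : ℂ :=
  g z * f z - proj m (fun v => g v * f v) z

/-- The Hankel operator with symbol `g` is a bounded operator `F^{p,m} → L^{p,m}`: for every
`f ∈ F^{p,m}` the integral that defines `P^m(g f)` converges absolutely at every point,
`H_g f` lies in `L^{p,m}`, and `‖H_g f‖_{p,m} ≤ C ‖f‖_{p,m}` with `C` independent of `f`. -/
def HankelBounded (p : ℝ) (m : ℕ) (g : ℂ → ℂ) : Prop :=
  (∀ f ∈ fockSobolev p m, ∀ z : ℂ, Integrable (projIntegrand m (fun v => g v * f v) z)) ∧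
  (∀ f ∈ fockSobolev p m, hankel m g f ∈ lebesguePM p m) ∧
  ∃ C : ℝ≥0, ∀ f ∈ fockSobolev p m, normPM p m (hankel m g f) ≤ C * normPM p m f

/-- The functions that are `p`-integrable on every compact set. -/
def lpLoc (p : ℝ) : Set (ℂ → ℂ) :=
  {g | AEStronglyMeasurable g ∧
    ∀ K : Set ℂ, IsCompact K → MemLp g (ENNReal.ofReal p) (volume.restrict K)}

/-- The average of `g` over the closed disk of centre `z` and radius `r`. -/
def diskAverage (r : ℝ) (g : ℂ → ℂ) (z : ℂ) : ℂ :=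
  (1 / ((Real.pi : ℂ) * (r : ℂ) ^ 2)) * ∫ v in Metric.closedBall z r, g v

/-- The seminorm `‖g‖_{BMO_r^p}`, as an extended nonnegative number. -/
def bmoNorm (p r : ℝ) (g : ℂ → ℂ) : ℝ≥0∞ :=
  ⨆ z : ℂ, (ENNReal.ofReal (1 / (Real.pi * r ^ 2)) *
    ∫⁻ v in Metric.closedBall z r, ‖g v - diskAverage r g z‖ₑ ^ p) ^ (1 / p)

/-- The space `BMO_r^p`. -/
def bmo (p r : ℝ) : Set (ℂ → ℂ) :=
  {g | g ∈ lpLoc p ∧ bmoNorm p r g < ∞}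

end

end FockSobolev

/-! Write `a` for the disk average of `g`, `B = 1 + |g - a|`, and `F = |f(v)| |v|^m e^{-|v|²/2}`.
Since `P^m f = f` (`proj_eq_self`), a Hankel operator does not see constants in its symbol, so at
each point `z` the constant `a(z)` may be subtracted: `H_g f(z) = (g(z) - a(z)) f(z) + P^m((a(z) -
g) f)(z)`.

With both Gaussian weights included, the kernel is at most a multiple of `e^{-|z-v|²/8}`
(`norm_kernel_mul_le`). Disk averages of a BMO function grow at most linearly in the distance, so
`|a(z) - g(v)| ≤ L B(v) e^{|z-v|²/16}` (`exists_bmo_bounds`). Hence the weighted modulus of `H_g f`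
is at most `B F` plus a multiple of the convolution of `B F` with the Gaussian `e^{-|·|²/16}`
(`exists_weighted_hankel_le`).

Young's inequality reduces everything to `‖B F‖_p ≤ C ‖F‖_p`. This is a Carleson embedding
(`lintegral_mul_rpow_le_of_local`): `B` has bounded local `L^p` means, and `F` is bounded by its own
local means because `f` is entire (`weighted_le_setLIntegral`).

Finiteness of `‖F‖_p` for `f` in the derivative-defined space is `lintegral_weighted_rpow_lt_top`.
The conjugate symbol needs no separate argument, as BMO is closed under conjugation. -/

namespace FockSobolev

/-! ### Rotation averages and radial moments of entire functions. -/

/-- The Taylor coefficients of an entire function as angular integrals over a circle. -/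
theorem integral_rotation_mul_pow {H : ℂ → ℂ} (hH : Differentiable ℂ H) (k : ℕ) (v : ℂ) :
    ∫ θ in (0 : ℝ)..2 * Real.pi,
        H (Complex.exp (θ * Complex.I) * v) *
          (starRingEnd ℂ (Complex.exp (θ * Complex.I) * v)) ^ k =
      2 * Real.pi * (iteratedDeriv k H 0 / k.factorial) * (‖v‖ ^ (2 * k) : ℝ) := by
  have hd : Differentiable ℂ fun ζ => H (v * ζ) := hH.comp (differentiable_id.const_mul v)
  -- Cauchy's formula is applied to `ζ ↦ H (v ζ)` on the unit circle, so `v = 0` is not a special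
  -- case.
  have h1 := hd.differentiableOn (s := Metric.closedBall 0 1) |>.circleIntegral_one_div_sub_center_pow_smul
    (c := 0) (R := 1) one_pos k
  have h2 := iteratedDeriv_comp_const_mul (n := k) (f := H) (hH.contDiff) v
  rw [h2] at h1
  simp only [circleIntegral, circleMap, deriv_circleMap] at h1
  simp only [zero_add, Complex.ofReal_one, one_mul, sub_zero, smul_eq_mul, mul_zero] at h1
  have h3 : ∫ θ in (0 : ℝ)..2 * Real.pi,
        H (Complex.exp (θ * Complex.I) * v) *
          (starRingEnd ℂ (Complex.exp (θ * Complex.I) * v)) ^ k =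
      -Complex.I * (starRingEnd ℂ v) ^ k * ∫ θ in (0 : ℝ)..2 * Real.pi,
       Complex.exp (θ * Complex.I) * Complex.I * (1 / Complex.exp (θ * Complex.I) ^ (k + 1) *
        H (v * Complex.exp (θ * Complex.I))) := by
    rw [← intervalIntegral.integral_const_mul]
    congr 1; ext θ
    have : (starRingEnd ℂ) (Complex.exp (θ * Complex.I)) = (Complex.exp (θ * Complex.I))⁻¹ := by
      rw [← Complex.exp_conj, ← Complex.exp_neg]; simp
    rw [map_mul, mul_pow, this, mul_comm v, inv_pow]
    have hne := Complex.exp_ne_zero (θ * Complex.I)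
    generalize Complex.exp (θ * Complex.I) = E at hne ⊢
    field_simp
    linear_combination (H (E * v) * (starRingEnd ℂ v) ^ k * E * E ^ k) * Complex.I_sq
  rw [h3, h1, pow_mul, Complex.ofReal_pow, ← Complex.normSq_eq_norm_sq, ← Complex.mul_conj, mul_pow]
  linear_combination (-(2 * Real.pi) * (iteratedDeriv k H 0 / k.factorial) * v ^ k * (starRingEnd ℂ v) ^ k) * Complex.I_sq

theorem measurePreserving_rotation (θ : ℝ) :
    MeasurePreserving (fun v : ℂ => Complex.exp (θ * Complex.I) * v) := by
  have := (rotation (Circle.exp θ)).measurePreserving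
  have he : (fun v : ℂ => Complex.exp (θ * Complex.I) * v) = rotation (Circle.exp θ) := by
    ext1 v; simp [rotation_apply]
  rwa [he]

/-- Moments of an entire function against a radial weight. -/
theorem integral_mul_conj_pow_mul_radial {H : ℂ → ℂ} (hH : Differentiable ℂ H) (k : ℕ)
    {ψ : ℝ → ℝ} (hψ : Measurable ψ)
    (hint : Integrable fun v : ℂ => H v * starRingEnd ℂ v ^ k * (ψ ‖v‖ : ℂ)) :
    ∫ v : ℂ, H v * starRingEnd ℂ v ^ k * (ψ ‖v‖ : ℂ) =
      iteratedDeriv k H 0 / k.factorial * ((∫ v : ℂ, ‖v‖ ^ (2 * k) * ψ ‖v‖ : ℝ) : ℂ) := by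
  set J : ℂ → ℂ := fun v => H v * starRingEnd ℂ v ^ k * (ψ ‖v‖ : ℂ) with hJ
  have hJm : Measurable J := by
    have := hH.continuous.measurable
    have h2 : Continuous fun v : ℂ => starRingEnd ℂ v ^ k := by fun_prop
    have := h2.measurable
    have : Measurable fun v : ℂ => (ψ ‖v‖ : ℂ) := Complex.measurable_ofReal.comp (hψ.comp measurable_norm)
    fun_prop
  have hrot : ∀ θ : ℝ, ∫ v, J (Complex.exp (θ * Complex.I) * v) = ∫ v, J v := fun θ => by
    have := (rotation (Circle.exp θ)).measurePreserving.integral_comp'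
      (f := (rotation (Circle.exp θ)).toHomeomorph.toMeasurableEquiv) J
    simpa [rotation_apply] using this
  have hrot' : ∀ θ : ℝ, ∫ v, ‖J (Complex.exp (θ * Complex.I) * v)‖ = ∫ v, ‖J v‖ := fun θ => by
    have := (rotation (Circle.exp θ)).measurePreserving.integral_comp'
      (f := (rotation (Circle.exp θ)).toHomeomorph.toMeasurableEquiv) (fun v => ‖J v‖)
    simpa [rotation_apply] using this
  have hprod : Integrable (Function.uncurry fun (θ : ℝ) (v : ℂ) => J (Complex.exp (θ * Complex.I) * v))
      ((volume.restrict (Set.uIoc 0 (2 * Real.pi))).prod volume) := by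
    have hm : Measurable (Function.uncurry fun (θ : ℝ) (v : ℂ) => J (Complex.exp (θ * Complex.I) * v)) := by
      apply hJm.comp
      apply Continuous.measurable
      fun_prop
    rw [integrable_prod_iff hm.aestronglyMeasurable]
    refine ⟨Filter.Eventually.of_forall fun θ => ?_, ?_⟩
    · exact (measurePreserving_rotation θ).integrable_comp_of_integrable hint
    · simp only [Function.uncurry]
      simp_rw [hrot']
      rw [Set.uIoc_of_le Real.two_pi_pos.le]
      exact integrable_const _
  -- Rotation invariance makes every inner integral over `v` equal to `∫ J`; in the other order the
  -- angular integral extracts the `k`-th Taylor coefficient.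
  have h1 := intervalIntegral_integral_swap hprod
  simp only [hrot] at h1
  rw [intervalIntegral.integral_const] at h1
  have h2 : ∀ v : ℂ, ∫ θ in (0 : ℝ)..2 * Real.pi, J (Complex.exp (θ * Complex.I) * v) =
      2 * Real.pi * (iteratedDeriv k H 0 / k.factorial) * ((‖v‖ ^ (2 * k) * ψ ‖v‖ : ℝ) : ℂ) := by
    intro v
    have hn : ∀ θ : ℝ, ‖Complex.exp (θ * Complex.I) * v‖ = ‖v‖ := fun θ => by
      rw [norm_mul, Complex.norm_exp_ofReal_mul_I, one_mul]
    simp only [hJ, hn]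
    rw [intervalIntegral.integral_mul_const, integral_rotation_mul_pow hH]
    push_cast; ring
  simp_rw [h2] at h1
  rw [integral_const_mul, integral_complex_ofReal, sub_zero, Complex.real_smul] at h1
  have hpi : (2 * Real.pi : ℂ) ≠ 0 := by simp [Real.pi_ne_zero]
  push_cast at h1
  apply mul_left_cancel₀ hpi
  rw [h1]; ring

/-! ### Integral inequalities: Hölder, Young, Carleson embedding. -/

theorem lintegral_rpow_le_measure_univ_mul {α : Type*} [MeasurableSpace α] (μ : Measure α)
    {p : ℝ} (hp : 1 ≤ p) {φ : α → ℝ≥0∞} (hφ : AEMeasurable φ μ) :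
    (∫⁻ a, φ a ∂μ) ^ p ≤ μ Set.univ ^ (p - 1) * ∫⁻ a, φ a ^ p ∂μ := by
  have h := eLpNorm'_le_eLpNorm'_mul_rpow_measure_univ (μ := μ) zero_lt_one hp hφ.aestronglyMeasurable
  simp only [eLpNorm', enorm_eq_self, ENNReal.rpow_one, div_one] at h
  have hp0 : 0 < p := by linarith
  refine (ENNReal.rpow_le_rpow h hp0.le).trans (le_of_eq ?_)
  rw [ENNReal.mul_rpow_of_nonneg _ _ hp0.le, ← ENNReal.rpow_mul, ← ENNReal.rpow_mul,
    one_div_mul_cancel hp0.ne', ENNReal.rpow_one, mul_comm]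
  congr 2
  field_simp

/-- Young's inequality `‖φ * κ‖_p ≤ ‖κ‖_1 ‖φ‖_p`. -/
theorem lintegral_convolution_rpow_le {p : ℝ} (hp : 1 ≤ p) {φ κ : ℂ → ℝ≥0∞}
    (hφ : AEMeasurable φ) (hκ : Measurable κ) :
    ∫⁻ z, (∫⁻ v, φ v * κ (z - v)) ^ p ≤ (∫⁻ w, κ w) ^ p * ∫⁻ v, φ v ^ p := by
  have hp0 : 0 < p := by linarith
  have hκz : ∀ z, Measurable fun v => κ (z - v) := fun z => hκ.comp (by fun_prop)
  have key : ∀ z, (∫⁻ v, φ v * κ (z - v)) ^ p ≤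
      (∫⁻ w, κ w) ^ (p - 1) * ∫⁻ v, φ v ^ p * κ (z - v) := by
    intro z
    -- Hölder is used for the measure `κ (z - v) dv`, whose total mass `∫ κ` does not depend on `z`.
    have hac : (volume.withDensity fun v => κ (z - v)) ≪ (volume : Measure ℂ) :=
      withDensity_absolutelyContinuous _ _
    have h := lintegral_rpow_le_measure_univ_mul (volume.withDensity fun v => κ (z - v)) hp
      (hφ.mono_ac hac)
    rw [lintegral_withDensity_eq_lintegral_mul₀ (hκz z).aemeasurable hφ,
      lintegral_withDensity_eq_lintegral_mul₀ (hκz z).aemeasurable (hφ.pow_const p),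
      withDensity_apply _ MeasurableSet.univ, Measure.restrict_univ,
      lintegral_sub_left_eq_self κ z] at h
    simpa only [Pi.mul_apply, mul_comm] using h
  have hm : AEMeasurable (Function.uncurry fun z v : ℂ => φ v ^ p * κ (z - v))
      (volume.prod volume) :=
    ((hφ.pow_const p).comp_quasiMeasurePreserving Measure.quasiMeasurePreserving_snd).mul
      (hκ.comp (measurable_fst.sub measurable_snd)).aemeasurable
  calc ∫⁻ z, (∫⁻ v, φ v * κ (z - v)) ^ p
      ≤ ∫⁻ z, (∫⁻ w, κ w) ^ (p - 1) * ∫⁻ v, φ v ^ p * κ (z - v) := lintegral_mono key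
    _ = (∫⁻ w, κ w) ^ (p - 1) * ∫⁻ z, ∫⁻ v, φ v ^ p * κ (z - v) :=
        lintegral_const_mul'' _ hm.lintegral_prod_right'
    _ = (∫⁻ w, κ w) ^ (p - 1) * ∫⁻ v, ∫⁻ z, φ v ^ p * κ (z - v) := by
        rw [lintegral_lintegral_swap hm]
    _ = (∫⁻ w, κ w) ^ (p - 1) * ((∫⁻ v, φ v ^ p) * ∫⁻ w, κ w) := by
        congr 1
        have : ∀ v, ∫⁻ z, φ v ^ p * κ (z - v) = φ v ^ p * ∫⁻ w, κ w := fun v => by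
          rw [lintegral_const_mul _ (by fun_prop : Measurable fun z => κ (z - v)),
            lintegral_sub_right_eq_self κ v]
        simp_rw [this]
        rw [lintegral_mul_const'' _ (hφ.pow_const p)]
    _ = _ := by
        rw [mul_comm (∫⁻ v, φ v ^ p), ← mul_assoc]
        congr 1
        nth_rewrite 2 [← ENNReal.rpow_one (∫⁻ w, κ w)]
        rw [← ENNReal.rpow_add_of_nonneg _ _ (by linarith) zero_le_one, sub_add_cancel]

theorem setLIntegral_closedBall_eq (φ : ℂ → ℝ≥0∞) (z : ℂ) (δ : ℝ) :
    ∫⁻ v in Metric.closedBall z δ, φ v =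
      ∫⁻ v, φ v * (Metric.closedBall 0 δ).indicator 1 (z - v) := by
  rw [← lintegral_indicator Metric.isClosed_closedBall.measurableSet]
  congr 1; ext v
  by_cases h : v ∈ Metric.closedBall z δ
  · rw [Set.indicator_of_mem h, Set.indicator_of_mem]
    · simp
    · rwa [mem_closedBall_zero_iff, ← dist_eq_norm, dist_comm]
  · rw [Set.indicator_of_notMem h, Set.indicator_of_notMem]
    · simp
    · rwa [mem_closedBall_zero_iff, ← dist_eq_norm, dist_comm]

theorem setLIntegral_closedBall_add (φ : ℂ → ℝ≥0∞) (z : ℂ) (δ : ℝ) :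
    ∫⁻ w in Metric.closedBall 0 δ, φ (z + w) = ∫⁻ v in Metric.closedBall z δ, φ v := by
  rw [← lintegral_indicator Metric.isClosed_closedBall.measurableSet,
    ← lintegral_indicator Metric.isClosed_closedBall.measurableSet,
    ← lintegral_add_left_eq_self ((Metric.closedBall z δ).indicator φ) z]
  congr 1; ext v
  simp only [Set.indicator, Metric.mem_closedBall, dist_self_add_left, dist_zero_right]

theorem lintegral_setLIntegral_closedBall_rpow_le {p : ℝ} (hp : 1 ≤ p) (δ : ℝ) :
    ∃ C : ℝ≥0, ∀ φ : ℂ → ℝ≥0∞, AEMeasurable φ →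
      ∫⁻ z, (∫⁻ v in Metric.closedBall z δ, φ v) ^ p ≤ C * ∫⁻ v, φ v ^ p := by
  have hb := Metric.isClosed_closedBall (x := (0 : ℂ)) (ε := δ) |>.measurableSet
  refine ⟨(volume (Metric.closedBall (0 : ℂ) δ) ^ p).toNNReal, fun φ hφ => ?_⟩
  rw [ENNReal.coe_toNNReal]
  · simp_rw [setLIntegral_closedBall_eq]
    refine (lintegral_convolution_rpow_le hp hφ (measurable_one.indicator hb)).trans (le_of_eq ?_)
    rw [lintegral_indicator_one hb]
  · exact ENNReal.rpow_ne_top_of_nonneg (by linarith)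
      (isCompact_closedBall 0 δ).measure_lt_top.ne

/-- A Carleson embedding: a factor with bounded local means is harmless against functions
that are dominated by their local means. -/
theorem lintegral_mul_rpow_le_of_local {p : ℝ} (hp : 1 ≤ p) (δ : ℝ) (M C : ℝ≥0)
    {B : ℂ → ℝ≥0∞} (hB : AEMeasurable B)
    (hBM : ∀ z, ∫⁻ v in Metric.closedBall z δ, B v ^ p ≤ M) :
    ∃ C' : ℝ≥0, ∀ φ : ℂ → ℝ≥0∞, AEMeasurable φ →
      (∀ z, φ z ≤ C * ∫⁻ v in Metric.closedBall z δ, φ v) →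
      ∫⁻ z, (B z * φ z) ^ p ≤ C' * ∫⁻ v, φ v ^ p := by
  have hp0 : 0 ≤ p := by linarith
  have hb := Metric.isClosed_closedBall (x := (0 : ℂ)) (ε := δ) |>.measurableSet
  set V := volume (Metric.closedBall (0 : ℂ) δ) with hV
  have hVt : V ≠ ∞ := (isCompact_closedBall 0 δ).measure_lt_top.ne
  have hD : (C : ℝ≥0∞) ^ p * V ^ (p - 1) ≠ ∞ :=
    ENNReal.mul_ne_top (ENNReal.rpow_ne_top_of_nonneg hp0 ENNReal.coe_ne_top)
      (ENNReal.rpow_ne_top_of_nonneg (by linarith) hVt)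
  set D := ((C : ℝ≥0∞) ^ p * V ^ (p - 1)).toNNReal
  have hDe : (D : ℝ≥0∞) = (C : ℝ≥0∞) ^ p * V ^ (p - 1) := ENNReal.coe_toNNReal hD
  refine ⟨D * M, fun φ hφ hloc => ?_⟩
  have key : ∀ z, (B z * φ z) ^ p ≤
      D * ∫⁻ v, B z ^ p * (φ v ^ p * (Metric.closedBall 0 δ).indicator 1 (z - v)) := by
    intro z
    rw [ENNReal.mul_rpow_of_nonneg _ _ hp0]
    have hm : AEMeasurable (fun v => φ v ^ p * (Metric.closedBall 0 δ).indicator 1 (z - v)) :=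
      (hφ.pow_const p).mul
        ((measurable_one.indicator hb).comp (measurable_const.sub measurable_id)).aemeasurable
    rw [lintegral_const_mul'' _ hm, ← setLIntegral_closedBall_eq, hDe, mul_left_comm]
    gcongr
    refine (ENNReal.rpow_le_rpow (hloc z) hp0).trans ?_
    rw [ENNReal.mul_rpow_of_nonneg _ _ hp0, mul_assoc]
    gcongr
    refine (lintegral_rpow_le_measure_univ_mul _ hp hφ.restrict).trans (le_of_eq ?_)
    rw [Measure.restrict_apply_univ, hV, Complex.volume_closedBall, Complex.volume_closedBall]
  have hm : AEMeasurable (Function.uncurry fun z v : ℂ =>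
      B z ^ p * (φ v ^ p * (Metric.closedBall 0 δ).indicator 1 (z - v)))
      (volume.prod volume) :=
    ((hB.pow_const p).comp_quasiMeasurePreserving Measure.quasiMeasurePreserving_fst).mul
      (((hφ.pow_const p).comp_quasiMeasurePreserving Measure.quasiMeasurePreserving_snd).mul
        ((measurable_one.indicator hb).comp (measurable_fst.sub measurable_snd)).aemeasurable)
  calc ∫⁻ z, (B z * φ z) ^ p ≤ ∫⁻ z, D * ∫⁻ v, B z ^ p * (φ v ^ p *
          (Metric.closedBall 0 δ).indicator 1 (z - v)) := lintegral_mono key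
    _ = D * ∫⁻ z, ∫⁻ v, B z ^ p * (φ v ^ p * (Metric.closedBall 0 δ).indicator 1 (z - v)) :=
        lintegral_const_mul'' _ hm.lintegral_prod_right'
    -- After Tonelli the condition `|z - v| ≤ δ`, being symmetric, confines `z` to a disk about `v`,
    -- where the mean of `B ^ p` is bounded.
    _ = D * ∫⁻ v, ∫⁻ z, B z ^ p * (φ v ^ p * (Metric.closedBall 0 δ).indicator 1 (z - v)) := by
        rw [lintegral_lintegral_swap hm]
    _ = D * ∫⁻ v, φ v ^ p * ∫⁻ z in Metric.closedBall v δ, B z ^ p := by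
        congr 2; ext v
        have hm2 : AEMeasurable (fun z => B z ^ p * (Metric.closedBall 0 δ).indicator 1 (v - z)) :=
          (hB.pow_const p).mul
            ((measurable_one.indicator hb).comp (measurable_const.sub measurable_id)).aemeasurable
        rw [setLIntegral_closedBall_eq, ← lintegral_const_mul'' _ hm2]
        congr 1; ext z
        have : (Metric.closedBall (0 : ℂ) δ).indicator (1 : ℂ → ℝ≥0∞) (z - v) =
            (Metric.closedBall 0 δ).indicator 1 (v - z) := by
          simp only [Set.indicator, mem_closedBall_zero_iff, norm_sub_rev, Pi.one_apply]
        rw [this, mul_left_comm]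
    _ ≤ D * ∫⁻ v, φ v ^ p * M := by
        gcongr with v
        exact hBM v
    _ = _ := by
        rw [lintegral_mul_const'' _ (hφ.pow_const p), ENNReal.coe_mul]
        ring

/-! ### Local mean estimates for entire functions with Gaussian weight. -/

/-- An area form of Cauchy's estimate: the radial moment formula with the indicator of the disk as
weight. Only `k = 0` (mean value property) and `k = 1` are needed later. -/
theorem enorm_iteratedDeriv_zero_le (k : ℕ) {δ : ℝ} (hδ : 0 < δ) :
    ∃ C : ℝ≥0, ∀ H : ℂ → ℂ, Differentiable ℂ H →
      ‖iteratedDeriv k H 0‖ₑ ≤ C * ∫⁻ w in Metric.closedBall 0 δ, ‖H w‖ₑ := by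
  set ψ : ℝ → ℝ := (Set.Iic δ).indicator 1 with hψ
  have hψm : Measurable ψ := measurable_one.indicator measurableSet_Iic
  have hbm := Metric.isClosed_closedBall (x := (0 : ℂ)) (ε := δ) |>.measurableSet
  have hind : ∀ φ : ℂ → ℂ, (fun v : ℂ => φ v * (ψ ‖v‖ : ℂ)) = (Metric.closedBall 0 δ).indicator φ := by
    intro φ; ext v
    by_cases h : ‖v‖ ≤ δ
    · rw [Set.indicator_of_mem (by simpa using h), hψ, Set.indicator_of_mem (by simpa using h)]; simp
    · rw [Set.indicator_of_notMem (by simpa using h), hψ,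
        Set.indicator_of_notMem (by simpa using h)]; simp
  have hindr : (fun v : ℂ => ‖v‖ ^ (2 * k) * ψ ‖v‖) =
      (Metric.closedBall 0 δ).indicator fun v : ℂ => ‖v‖ ^ (2 * k) := by
    ext v
    by_cases h : ‖v‖ ≤ δ
    · rw [Set.indicator_of_mem (by simpa using h), hψ, Set.indicator_of_mem (by simpa using h)]; simp
    · rw [Set.indicator_of_notMem (by simpa using h), hψ,
        Set.indicator_of_notMem (by simpa using h)]; simp
  set c : ℝ := ∫ v : ℂ, ‖v‖ ^ (2 * k) * ψ ‖v‖ with hc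
  have hcpos : 0 < c := by
    rw [hc, hindr, integral_indicator hbm]
    have hio : IntegrableOn (fun v : ℂ => ‖v‖ ^ (2 * k)) (Metric.closedBall 0 δ) :=
      (by fun_prop : Continuous fun v : ℂ => ‖v‖ ^ (2 * k)).continuousOn.integrableOn_compact
        (isCompact_closedBall 0 δ)
    rw [setIntegral_pos_iff_support_of_nonneg_ae
      (Filter.Eventually.of_forall fun v => by positivity) hio]
    -- The open disk of centre and radius `δ / 2` lies in the large disk and avoids the origin,
    -- where the integrand may vanish.
    refine lt_of_lt_of_le ?_ (measure_mono (?_ : Metric.ball ((δ / 2 : ℝ) : ℂ) (δ / 2) ⊆ _))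
    · exact Metric.measure_ball_pos _ _ (by linarith)
    · intro v hv
      rw [Metric.mem_ball, dist_eq_norm] at hv
      have h1 : ‖((δ / 2 : ℝ) : ℂ)‖ = δ / 2 := by
        rw [Complex.norm_real, Real.norm_eq_abs, abs_of_pos (by linarith)]
      constructor
      · rw [Function.mem_support]
        have : v ≠ 0 := by
          rintro rfl
          rw [zero_sub, norm_neg, h1] at hv
          exact lt_irrefl _ hv
        exact pow_ne_zero _ (norm_ne_zero_iff.mpr this)
      · rw [mem_closedBall_zero_iff]
        have := norm_sub_norm_le v ((δ / 2 : ℝ) : ℂ)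
        linarith
  refine ⟨(k.factorial / c * δ ^ k).toNNReal, fun H hH => ?_⟩
  have hcont : Continuous fun v : ℂ => H v * starRingEnd ℂ v ^ k := by
    have := hH.continuous
    fun_prop
  have hint : Integrable fun v : ℂ => H v * starRingEnd ℂ v ^ k * (ψ ‖v‖ : ℂ) := by
    rw [hind, integrable_indicator_iff hbm]
    exact hcont.continuousOn.integrableOn_compact (isCompact_closedBall 0 δ)
  have h1 := integral_mul_conj_pow_mul_radial hH k hψm hint
  rw [← hc, hind, integral_indicator hbm] at h1
  have h2 : iteratedDeriv k H 0 = ((k.factorial / c : ℝ) : ℂ) *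
      ∫ v in Metric.closedBall 0 δ, H v * starRingEnd ℂ v ^ k := by
    have hc0 : (c : ℂ) ≠ 0 := by exact_mod_cast hcpos.ne'
    have hk0 : (k.factorial : ℂ) ≠ 0 := by exact_mod_cast k.factorial_ne_zero
    rw [h1]; push_cast; field_simp
  have hk : 0 ≤ (k.factorial : ℝ) / c := by positivity
  rw [h2, enorm_mul, Real.toNNReal_mul hk, ENNReal.coe_mul, mul_assoc]
  have h3 : ‖((k.factorial / c : ℝ) : ℂ)‖ₑ = ((k.factorial / c : ℝ).toNNReal : ℝ≥0∞) := by
    rw [← ofReal_norm, Complex.norm_real, Real.norm_of_nonneg hk]; rfl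
  rw [h3]
  gcongr
  refine (enorm_integral_le_lintegral_enorm _).trans ?_
  rw [← lintegral_const_mul _ hH.continuous.enorm.measurable]
  refine setLIntegral_mono (by have := hH.continuous.enorm.measurable; fun_prop) fun v hv => ?_
  rw [enorm_mul, mul_comm]
  gcongr
  rw [← ofReal_norm, norm_pow, RCLike.norm_conj]
  apply ENNReal.ofReal_le_ofReal
  gcongr
  simpa using hv

/-- The modulus of `f` times the weight `|v|^m e^{-|v|²/2}`. -/
noncomputable def weighted (m : ℕ) (f : ℂ → ℂ) (v : ℂ) : ℝ≥0∞ :=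
  ‖f v‖ₑ * ENNReal.ofReal (‖v‖ ^ m * Real.exp (-‖v‖ ^ 2 / 2))

theorem weighted_eq_weighted_zero (m : ℕ) (f : ℂ → ℂ) :
    weighted m f = weighted 0 (fun v => v ^ m * f v) := by
  ext v
  simp only [weighted, enorm_mul, pow_zero, one_mul]
  rw [ENNReal.ofReal_mul (by positivity), ← norm_pow, ofReal_norm]
  ring

/-- Multiplying `h(z + w)` by `e^{-z̄ w - |z|²/2}` turns its modulus into the weighted modulus at
`z + w`, up to a factor that depends only on `|w|`. -/
theorem enorm_recentred (h : ℂ → ℂ) (z w : ℂ) :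
    ‖h (z + w) * Complex.exp (-(starRingEnd ℂ z * w) - (‖z‖ ^ 2 / 2 : ℝ))‖ₑ =
      weighted 0 h (z + w) * ENNReal.ofReal (Real.exp (‖w‖ ^ 2 / 2)) := by
  rw [weighted, enorm_mul, mul_assoc, ← ENNReal.ofReal_mul (by positivity), pow_zero, one_mul,
    ← Real.exp_add]
  congr 1
  rw [← ofReal_norm, Complex.norm_exp]
  congr 2
  rw [← Complex.normSq_eq_norm_sq, ← Complex.normSq_eq_norm_sq, ← Complex.normSq_eq_norm_sq]
  simp [Complex.normSq_apply]
  ring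

theorem setLIntegral_recentred_le (h : ℂ → ℂ) (z : ℂ) (δ : ℝ) :
    ∫⁻ w in Metric.closedBall 0 δ,
        ‖h (z + w) * Complex.exp (-(starRingEnd ℂ z * w) - (‖z‖ ^ 2 / 2 : ℝ))‖ₑ ≤
      ENNReal.ofReal (Real.exp (δ ^ 2 / 2)) * ∫⁻ v in Metric.closedBall z δ, weighted 0 h v := by
  simp_rw [enorm_recentred]
  rw [← setLIntegral_closedBall_add (weighted 0 h), ← lintegral_const_mul' _ _ ENNReal.ofReal_ne_top]
  refine setLIntegral_mono' (Metric.isClosed_closedBall (x := (0 : ℂ)) (ε := δ)).measurableSet fun w hw => ?_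
  rw [mul_comm]
  gcongr
  simpa using hw

/-- The mean value property is applied to the entire function `w ↦ h(z + w) e^{-z̄ w - |z|²/2}`,
with `v^m` first absorbed into `h`. The recentring costs only `e^{δ²/2}`, so the constant is uniform
in `z`. -/
theorem weighted_le_setLIntegral (m : ℕ) {δ : ℝ} (hδ : 0 < δ) :
    ∃ C : ℝ≥0, ∀ h : ℂ → ℂ, Differentiable ℂ h → ∀ z : ℂ,
      weighted m h z ≤ C * ∫⁻ v in Metric.closedBall z δ, weighted m h v := by
  obtain ⟨C, hC⟩ := enorm_iteratedDeriv_zero_le 0 hδ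
  refine ⟨C * (Real.exp (δ ^ 2 / 2)).toNNReal, fun h' hh' z => ?_⟩
  simp_rw [weighted_eq_weighted_zero m h']
  set h : ℂ → ℂ := fun v => v ^ m * h' v with hdef
  have hh : Differentiable ℂ h := by fun_prop
  have := hC (fun w => h (z + w) * Complex.exp (-(starRingEnd ℂ z * w) - (‖z‖ ^ 2 / 2 : ℝ)))
    (by fun_prop)
  rw [iteratedDeriv_zero, enorm_recentred, add_zero] at this
  simp only [norm_zero, ne_eq, OfNat.ofNat_ne_zero, not_false_eq_true, zero_pow, zero_div,
    Real.exp_zero, ENNReal.ofReal_one, mul_one] at this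
  refine this.trans ?_
  rw [ENNReal.coe_mul, mul_assoc]
  gcongr
  exact setLIntegral_recentred_le h z δ

/-- This trades a power of `|z|` for a derivative: the recentred function has derivative `(h'(z) -
z̄ h(z)) e^{-|z|²/2}` at `w = 0`, which the area Cauchy estimate controls. -/
theorem enorm_mul_weighted_le {δ : ℝ} (hδ : 0 < δ) :
    ∃ C : ℝ≥0, ∀ h : ℂ → ℂ, Differentiable ℂ h → ∀ z : ℂ,
      weighted 1 h z ≤ weighted 0 (deriv h) z +
        C * ∫⁻ v in Metric.closedBall z δ, weighted 0 h v := by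
  obtain ⟨C, hC⟩ := enorm_iteratedDeriv_zero_le 1 hδ
  refine ⟨C * (Real.exp (δ ^ 2 / 2)).toNNReal, fun h hh z => ?_⟩
  have h0 := hC (fun w => h (z + w) * Complex.exp (-(starRingEnd ℂ z * w) - (‖z‖ ^ 2 / 2 : ℝ)))
    (by fun_prop)
  have hd : deriv (fun w => h (z + w) *
      Complex.exp (-(starRingEnd ℂ z * w) - (‖z‖ ^ 2 / 2 : ℝ))) 0 =
      (deriv h z - starRingEnd ℂ z * h z) * Complex.exp (-(‖z‖ ^ 2 / 2 : ℝ)) := by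
    have h1 : HasDerivAt (fun w => h (z + w)) (deriv h (z + 0)) 0 :=
      (hh (z + 0)).hasDerivAt.comp_const_add z 0
    have h2 : HasDerivAt (fun w : ℂ => -(starRingEnd ℂ z * w) - ((‖z‖ ^ 2 / 2 : ℝ) : ℂ))
        (-(starRingEnd ℂ z * 1)) 0 :=
      (((hasDerivAt_id (0 : ℂ)).const_mul (starRingEnd ℂ z)).neg).sub_const _
    refine (h1.fun_mul h2.cexp).deriv.trans ?_
    simp; ring
  rw [iteratedDeriv_one, hd] at h0
  have hsplit : weighted 1 h z ≤ weighted 0 (deriv h) z +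
      ‖(deriv h z - starRingEnd ℂ z * h z) * Complex.exp (-(‖z‖ ^ 2 / 2 : ℝ))‖ₑ := by
    have he : ‖Complex.exp (-(‖z‖ ^ 2 / 2 : ℝ))‖ₑ = ENNReal.ofReal (Real.exp (-‖z‖ ^ 2 / 2)) := by
      rw [← ofReal_norm, Complex.norm_exp]
      congr 2
      rw [← Complex.ofReal_neg, Complex.ofReal_re]; ring
    have e1 : weighted 1 h z = ‖starRingEnd ℂ z * h z * Complex.exp (-(‖z‖ ^ 2 / 2 : ℝ))‖ₑ := by
      rw [enorm_mul, enorm_mul, he, weighted, pow_one, ENNReal.ofReal_mul (norm_nonneg z),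
        ofReal_norm]
      have : ‖starRingEnd ℂ z‖ₑ = ‖z‖ₑ := by
        rw [← ofReal_norm, RCLike.norm_conj, ofReal_norm]
      rw [this]; ring
    have e2 : weighted 0 (deriv h) z = ‖deriv h z * Complex.exp (-(‖z‖ ^ 2 / 2 : ℝ))‖ₑ := by
      rw [enorm_mul, he, weighted, pow_zero, one_mul]
    rw [e1, e2]
    refine le_trans (le_of_eq ?_) (enorm_sub_le (E := ℂ))
    congr 1; ring
  refine hsplit.trans ?_
  gcongr
  refine h0.trans ?_
  rw [ENNReal.coe_mul, mul_assoc]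
  gcongr
  exact setLIntegral_recentred_le h z δ

/-! ### Weighted `L^p` norms and their finiteness on the Fock–Sobolev space. -/

theorem weighted_rpow {p : ℝ} (hp : 0 ≤ p) (m : ℕ) (f : ℂ → ℂ) (v : ℂ) :
    weighted m f v ^ p = ‖f v‖ₑ ^ p *
      ENNReal.ofReal (‖v‖ ^ ((m : ℝ) * p) * Real.exp (-(p / 2) * ‖v‖ ^ 2)) := by
  rw [weighted, ENNReal.mul_rpow_of_nonneg _ _ hp, ENNReal.ofReal_rpow_of_nonneg (by positivity) hp,
    Real.mul_rpow (by positivity) (by positivity), ← Real.exp_mul, Real.rpow_mul (norm_nonneg v),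
    Real.rpow_natCast]
  congr 4; ring

theorem normPM_eq {p : ℝ} (hp : 0 ≤ p) (m : ℕ) (f : ℂ → ℂ) :
    normPM p m f = (ENNReal.ofReal (omega p m) * ∫⁻ v, weighted m f v ^ p) ^ (1 / p) := by
  simp_rw [normPM, weighted_rpow hp]

theorem lintegral_weighted_zero_rpow_lt_top {p : ℝ} (hp : 1 ≤ p) {f : ℂ → ℂ}
    (hf : fockNorm p f < ∞) : ∫⁻ v, weighted 0 f v ^ p < ∞ := by
  have hp0 : 0 < p := by linarith
  have h : fockNorm p f =
      (ENNReal.ofReal (p / (2 * Real.pi)) * ∫⁻ v, weighted 0 f v ^ p) ^ (1 / p) := by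
    simp_rw [fockNorm, weighted_rpow hp0.le]
    simp
  rw [h, ENNReal.rpow_lt_top_iff_of_pos (by positivity)] at hf
  have hc : ENNReal.ofReal (p / (2 * Real.pi)) ≠ 0 := by
    have := Real.pi_pos
    simp only [ne_eq, ENNReal.ofReal_eq_zero, not_le]
    positivity
  exact ENNReal.lt_top_of_mul_ne_top_right hf.ne hc

theorem normPM_le_of_lintegral_le {p : ℝ} (hp : 1 ≤ p) (m : ℕ) {C : ℝ≥0} {u f : ℂ → ℂ}
    (h : ∫⁻ v, weighted m u v ^ p ≤ C * ∫⁻ v, weighted m f v ^ p) :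
    normPM p m u ≤ (C ^ (1 / p) : ℝ≥0) * normPM p m f := by
  have hp0 : 0 < p := by linarith
  rw [normPM_eq hp0.le, normPM_eq hp0.le, ENNReal.coe_rpow_of_nonneg _ (by positivity),
    ← ENNReal.mul_rpow_of_nonneg _ _ (by positivity), mul_left_comm]
  gcongr

theorem mem_lebesguePM {p : ℝ} (hp : 1 ≤ p) (m : ℕ) {u : ℂ → ℂ} (hu : AEStronglyMeasurable u)
    (h : ∫⁻ v, weighted m u v ^ p < ∞) : u ∈ lebesguePM p m := by
  have hp0 : 0 < p := by linarith
  refine ⟨hu, hu.mul (Continuous.aestronglyMeasurable (by fun_prop)), ?_⟩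
  rw [eLpNorm_lt_top_iff_lintegral_rpow_enorm_lt_top (by simpa using hp0) ENNReal.ofReal_ne_top,
    ENNReal.toReal_ofReal hp0.le]
  refine lt_of_le_of_lt (le_of_eq ?_) h
  congr 1; ext v
  rw [weighted, enorm_mul, ← ofReal_norm (Complex.ofReal _), Complex.norm_real,
    Real.norm_of_nonneg (by positivity)]

theorem aemeasurable_weighted (m : ℕ) {f : ℂ → ℂ} (hf : AEStronglyMeasurable f) :
    AEMeasurable (weighted m f) := by
  exact hf.enorm.mul (Continuous.measurable (by fun_prop)).ennreal_ofReal.aemeasurable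

theorem lintegral_add_rpow_lt_top {p : ℝ} (hp : 1 ≤ p) {a b : ℂ → ℝ≥0∞} (ha : AEMeasurable a)
    (hfa : ∫⁻ v, a v ^ p < ∞) (hfb : ∫⁻ v, b v ^ p < ∞) :
    ∫⁻ v, (a v + b v) ^ p < ∞ := by
  refine lt_of_le_of_lt (lintegral_mono fun v => ENNReal.rpow_add_le_mul_rpow_add_rpow _ _ hp) ?_
  have h2 : (2 : ℝ≥0∞) ^ (p - 1) ≠ ∞ :=
    ENNReal.rpow_ne_top_of_nonneg (by linarith) (by simp)
  rw [lintegral_const_mul' _ _ h2, lintegral_add_left' (ha.pow_const p)]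
  exact ENNReal.mul_lt_top h2.lt_top (ENNReal.add_lt_top.mpr ⟨hfa, hfb⟩)

theorem lintegral_const_mul_rpow_lt_top {p : ℝ} (hp : 1 ≤ p) {a : ℂ → ℝ≥0∞} (C : ℝ≥0)
    (hfa : ∫⁻ v, a v ^ p < ∞) : ∫⁻ v, (C * a v) ^ p < ∞ := by
  have hp0 : 0 ≤ p := by linarith
  have hC : (C : ℝ≥0∞) ^ p ≠ ∞ := ENNReal.rpow_ne_top_of_nonneg hp0 ENNReal.coe_ne_top
  simp_rw [ENNReal.mul_rpow_of_nonneg _ _ hp0]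
  rw [lintegral_const_mul' _ _ hC]
  exact ENNReal.mul_lt_top hC.lt_top hfa

theorem lintegral_weighted_one_rpow_lt_top {p : ℝ} (hp : 1 ≤ p) {h : ℂ → ℂ}
    (hh : Differentiable ℂ h) (h0 : ∫⁻ v, weighted 0 h v ^ p < ∞)
    (h1 : ∫⁻ v, weighted 0 (deriv h) v ^ p < ∞) : ∫⁻ v, weighted 1 h v ^ p < ∞ := by
  obtain ⟨C, hC⟩ := enorm_mul_weighted_le one_pos
  obtain ⟨D, hD⟩ := lintegral_setLIntegral_closedBall_rpow_le hp 1
  refine lt_of_le_of_lt (lintegral_mono fun v => ENNReal.rpow_le_rpow (hC h hh v) (by linarith)) ?_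
  refine lintegral_add_rpow_lt_top hp
    (aemeasurable_weighted 0 hh.deriv.continuous.aestronglyMeasurable) h1
    (lintegral_const_mul_rpow_lt_top hp C ?_)
  exact (hD _ (aemeasurable_weighted 0 hh.continuous.aestronglyMeasurable)).trans_lt
    (ENNReal.mul_lt_top ENNReal.coe_lt_top h0)

theorem weighted_le_add (m : ℕ) (f : ℂ → ℂ) (v : ℂ) :
    weighted m f v ≤ weighted 0 f v + weighted (m + 1) f v := by
  simp only [weighted]
  rw [← mul_add, ← ENNReal.ofReal_add (by positivity) (by positivity)]
  gcongr
  rw [← add_mul]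
  gcongr
  rcases le_total ‖v‖ 1 with h | h
  · have := pow_le_one₀ (n := m) (norm_nonneg v) h
    have := pow_nonneg (norm_nonneg v) (m + 1)
    linarith
  · have := pow_le_pow_right₀ h (Nat.le_add_right m 1)
    simp only [pow_zero]
    linarith

theorem weighted_deriv_pow_mul_le (m : ℕ) {f : ℂ → ℂ} (hf : Differentiable ℂ f) (v : ℂ) :
    weighted 0 (deriv fun v => v ^ m * f v) v ≤
      (m : ℝ≥0) * (weighted 0 f v + weighted m f v) + weighted m (deriv f) v := by
  have hd : deriv (fun v => v ^ m * f v) v = m * (v ^ (m - 1) * f v) + v ^ m * deriv f v := by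
    refine ((hasDerivAt_pow m v).fun_mul (hf v).hasDerivAt).deriv.trans ?_
    ring
  have h1 : weighted 0 (deriv fun v => v ^ m * f v) v ≤
      m * weighted (m - 1) f v + weighted m (deriv f) v := by
    rw [weighted_eq_weighted_zero (m - 1), weighted_eq_weighted_zero m]
    simp only [weighted]
    rw [hd, ← mul_assoc (m : ℝ≥0∞), ← add_mul]
    gcongr
    refine (enorm_add_le _ _).trans ?_
    rw [enorm_mul]
    gcongr
    rw [← ofReal_norm, Complex.norm_natCast, ENNReal.ofReal_natCast]
  refine h1.trans ?_
  cases m with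
  | zero => simp
  | succ n =>
    push_cast
    gcongr
    simpa using weighted_le_add n f v

/-- Induction on `m`, applying the degree-one estimate to `v^m f`. Its derivative is `m v^{m-1} f +
v^m f'`: the first term is of lower order, and the second is covered by the induction hypothesis for
`f'`. -/
theorem lintegral_weighted_rpow_lt_top {p : ℝ} (hp : 1 ≤ p) (m : ℕ) :
    ∀ f : ℂ → ℂ, Differentiable ℂ f →
      (∀ k ≤ m, ∫⁻ v, weighted 0 (iteratedDeriv k f) v ^ p < ∞) →
      ∫⁻ v, weighted m f v ^ p < ∞ := by
  induction m with
  | zero => intro f _ h; simpa using h 0 le_rfl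
  | succ m ih =>
    intro f hf h
    have hfm : ∫⁻ v, weighted m f v ^ p < ∞ := ih f hf fun k hk => h k (by omega)
    have hf0 : ∫⁻ v, weighted 0 f v ^ p < ∞ := by simpa using h 0 (by omega)
    have hdm : ∫⁻ v, weighted m (deriv f) v ^ p < ∞ := ih _ hf.deriv fun k hk => by
      rw [← iteratedDeriv_succ']
      exact h (k + 1) (by omega)
    have hd : Differentiable ℂ fun v => v ^ m * f v := by fun_prop
    have hfc := hf.continuous.aestronglyMeasurable (μ := (volume : Measure ℂ))
    have e : weighted (m + 1) f = weighted 1 fun v => v ^ m * f v := by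
      rw [weighted_eq_weighted_zero, weighted_eq_weighted_zero 1]
      congr 1; ext v; ring
    rw [e]
    refine lintegral_weighted_one_rpow_lt_top hp hd ?_ ?_
    · rwa [← weighted_eq_weighted_zero]
    · refine lt_of_le_of_lt (lintegral_mono fun v =>
        ENNReal.rpow_le_rpow (weighted_deriv_pow_mul_le m hf v) (by linarith)) ?_
      exact lintegral_add_rpow_lt_top hp
        (((aemeasurable_weighted 0 hfc).add (aemeasurable_weighted m hfc)).const_mul _)
        (lintegral_const_mul_rpow_lt_top hp _
          (lintegral_add_rpow_lt_top hp (aemeasurable_weighted 0 hfc) hf0 hfm)) hdm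

theorem lintegral_weighted_rpow_lt_top_of_mem {p : ℝ} (hp : 1 ≤ p) {m : ℕ} {f : ℂ → ℂ}
    (hf : f ∈ fockSobolev p m) : ∫⁻ v, weighted m f v ^ p < ∞ := by
  refine lintegral_weighted_rpow_lt_top hp m f hf.1 fun k hk => ?_
  exact lintegral_weighted_zero_rpow_lt_top hp
    (ENNReal.sum_lt_top.mp hf.2 k (Finset.mem_range.mpr (by omega)))

/-! ### The kernel: series, closed form, off-diagonal decay. -/

theorem norm_kernel_term_le (m k : ℕ) (ζ : ℂ) :
    ‖((m.factorial : ℂ) / ((k + m).factorial : ℂ)) * ζ ^ k‖ ≤ ‖ζ‖ ^ k / k.factorial := by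
  rw [norm_mul, norm_div, Complex.norm_natCast, Complex.norm_natCast, norm_pow, mul_comm,
    ← mul_div_assoc, div_le_div_iff₀ (by positivity) (by positivity), mul_assoc]
  gcongr
  rw [add_comm]
  exact_mod_cast Nat.le_of_dvd (Nat.factorial_pos _) (Nat.factorial_mul_factorial_dvd_factorial_add m k)

theorem hasSum_kernel (m : ℕ) (z v : ℂ) :
    HasSum (fun k : ℕ => ((m.factorial : ℂ) / ((k + m).factorial : ℂ)) *
      (starRingEnd ℂ z * v) ^ k) (kernel m z v) :=
  (Summable.of_norm_bounded (Real.summable_pow_div_factorial _)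
    fun k => norm_kernel_term_le m k _).hasSum

theorem norm_kernel_le (m : ℕ) (z v : ℂ) : ‖kernel m z v‖ ≤ Real.exp (‖z‖ * ‖v‖) := by
  refine tsum_of_norm_bounded (g := fun k : ℕ => (‖z‖ * ‖v‖) ^ k / k.factorial) ?_ fun k => ?_
  · rw [Real.exp_eq_exp_ℝ]
    exact NormedSpace.expSeries_div_hasSum_exp _
  · have := norm_kernel_term_le m k (starRingEnd ℂ z * v)
    rwa [norm_mul (starRingEnd ℂ z), RCLike.norm_conj] at this

theorem measurable_kernel (m : ℕ) : Measurable (Function.uncurry (kernel m)) := by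
  refine measurable_of_tendsto_metrizable (f := fun (n : ℕ) (x : ℂ × ℂ) =>
    ∑ k ∈ Finset.range n, ((m.factorial : ℂ) / ((k + m).factorial : ℂ)) *
      (starRingEnd ℂ x.1 * x.2) ^ k) (fun n => ?_) ?_
  · exact Continuous.measurable (by fun_prop)
  · rw [tendsto_pi_nhds]
    exact fun x => (hasSum_kernel m x.1 x.2).tendsto_sum_nat

/-- The closed form of the kernel: a truncated exponential. -/
theorem pow_mul_kernel (m : ℕ) (z v : ℂ) :
    (starRingEnd ℂ z * v) ^ m * kernel m z v = m.factorial *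
      (Complex.exp (starRingEnd ℂ z * v) -
        ∑ k ∈ Finset.range m, (starRingEnd ℂ z * v) ^ k / k.factorial) := by
  set ζ := starRingEnd ℂ z * v with hζ
  have h1 : HasSum (fun k : ℕ => ζ ^ k / k.factorial) (Complex.exp ζ) := by
    rw [Complex.exp_eq_exp_ℂ]
    exact NormedSpace.expSeries_div_hasSum_exp _
  have h2 := ((hasSum_nat_add_iff' m).mpr h1).mul_left (m.factorial : ℂ)
  have h3 := (hasSum_kernel m z v).mul_left (ζ ^ m)
  refine h3.unique (h2.congr_fun ?_)
  intro k
  rw [← hζ, pow_add]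
  ring

/-- The factor `|z|^m |v|^m` brings in the closed form. Its exponential, once weighted, has modulus
exactly `e^{-|z-v|²/2}`. The Taylor polynomial is `O(e^{|z||v|/2})`, which after weighting is at
most `e^{-(|z|²+|v|²)/4} ≤ e^{-|z-v|²/8}`; this term fixes the rate `1/8`. -/
theorem norm_kernel_mul_le (m : ℕ) :
    ∃ C : ℝ, 0 ≤ C ∧ ∀ z v : ℂ, ‖kernel m z v‖ * (‖z‖ ^ m * ‖v‖ ^ m) *
      Real.exp (-(‖z‖ ^ 2 + ‖v‖ ^ 2) / 2) ≤ C * Real.exp (-‖z - v‖ ^ 2 / 8) := by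
  refine ⟨m.factorial * (1 + ∑ k ∈ Finset.range m, (2 : ℝ) ^ k), by positivity, fun z v => ?_⟩
  have hsq : ‖z - v‖ ^ 2 = ‖z‖ ^ 2 + ‖v‖ ^ 2 - 2 * (starRingEnd ℂ z * v).re := by
    rw [← Complex.normSq_eq_norm_sq, ← Complex.normSq_eq_norm_sq, ← Complex.normSq_eq_norm_sq]
    simp [Complex.normSq_apply]
    ring
  have hle : ‖z - v‖ ^ 2 ≤ 2 * (‖z‖ ^ 2 + ‖v‖ ^ 2) := by
    have := norm_sub_le z v
    nlinarith [sq_nonneg (‖z‖ - ‖v‖), norm_nonneg (z - v), norm_nonneg z, norm_nonneg v]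
  have h1 : ‖kernel m z v‖ * (‖z‖ ^ m * ‖v‖ ^ m) = ‖(m.factorial : ℂ) *
      (Complex.exp (starRingEnd ℂ z * v) -
        ∑ k ∈ Finset.range m, (starRingEnd ℂ z * v) ^ k / k.factorial)‖ := by
    rw [← pow_mul_kernel, norm_mul, norm_pow, norm_mul, RCLike.norm_conj, mul_pow]
    ring
  have h2 : ‖∑ k ∈ Finset.range m, (starRingEnd ℂ z * v) ^ k / k.factorial‖ ≤
      (∑ k ∈ Finset.range m, (2 : ℝ) ^ k) * Real.exp (‖z‖ * ‖v‖ / 2) := by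
    rw [Finset.sum_mul]
    refine norm_sum_le_of_le _ fun k _ => ?_
    have := Real.pow_div_factorial_le_exp (‖z‖ * ‖v‖ / 2) (by positivity) k
    rw [norm_div, norm_pow, norm_mul, RCLike.norm_conj, Complex.norm_natCast]
    calc (‖z‖ * ‖v‖) ^ k / k.factorial = 2 ^ k * ((‖z‖ * ‖v‖ / 2) ^ k / k.factorial) := by
          rw [div_pow]; field_simp
      _ ≤ _ := by gcongr
  have h3 : Real.exp (starRingEnd ℂ z * v).re * Real.exp (-(‖z‖ ^ 2 + ‖v‖ ^ 2) / 2) ≤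
      Real.exp (-‖z - v‖ ^ 2 / 8) := by
    rw [← Real.exp_add]
    apply Real.exp_le_exp.mpr
    nlinarith [sq_nonneg ‖z - v‖]
  have h4 : Real.exp (‖z‖ * ‖v‖ / 2) * Real.exp (-(‖z‖ ^ 2 + ‖v‖ ^ 2) / 2) ≤
      Real.exp (-‖z - v‖ ^ 2 / 8) := by
    rw [← Real.exp_add]
    apply Real.exp_le_exp.mpr
    nlinarith [sq_nonneg (‖z‖ - ‖v‖)]
  rw [h1, norm_mul, Complex.norm_natCast, mul_assoc, mul_assoc (m.factorial : ℝ)]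
  refine mul_le_mul_of_nonneg_left ?_ (by positivity)
  calc _ ≤ (Real.exp (starRingEnd ℂ z * v).re + (∑ k ∈ Finset.range m, (2 : ℝ) ^ k) *
        Real.exp (‖z‖ * ‖v‖ / 2)) * Real.exp (-(‖z‖ ^ 2 + ‖v‖ ^ 2) / 2) := by
        gcongr
        refine (norm_sub_le _ _).trans ?_
        rw [Complex.norm_exp]
        gcongr
    _ = Real.exp (starRingEnd ℂ z * v).re * Real.exp (-(‖z‖ ^ 2 + ‖v‖ ^ 2) / 2) +
        (∑ k ∈ Finset.range m, (2 : ℝ) ^ k) *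
          (Real.exp (‖z‖ * ‖v‖ / 2) * Real.exp (-(‖z‖ ^ 2 + ‖v‖ ^ 2) / 2)) := by ring
    _ ≤ 1 * Real.exp (-‖z - v‖ ^ 2 / 8) + (∑ k ∈ Finset.range m, (2 : ℝ) ^ k) *
          Real.exp (-‖z - v‖ ^ 2 / 8) := by
        rw [one_mul]; gcongr
    _ = _ := by ring

/-- The weight `|v|^{2m} e^{-|v|²}` is split into two equal factors, one for `h` and one for the
kernel. -/
theorem enorm_projIntegrand_mul_le (m : ℕ) :
    ∃ C : ℝ≥0, ∀ (h : ℂ → ℂ) (z v : ℂ),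
      ‖projIntegrand m h z v‖ₑ * ENNReal.ofReal (‖z‖ ^ m * Real.exp (-‖z‖ ^ 2 / 2)) ≤
        C * (weighted m h v * ENNReal.ofReal (Real.exp (-‖z - v‖ ^ 2 / 8))) := by
  obtain ⟨C, hC0, hC⟩ := norm_kernel_mul_le m
  refine ⟨C.toNNReal, fun h z v => ?_⟩
  have e : ‖projIntegrand m h z v‖ₑ * ENNReal.ofReal (‖z‖ ^ m * Real.exp (-‖z‖ ^ 2 / 2)) =
      weighted m h v * ENNReal.ofReal (‖kernel m z v‖ * (‖z‖ ^ m * ‖v‖ ^ m) *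
        Real.exp (-(‖z‖ ^ 2 + ‖v‖ ^ 2) / 2)) := by
    rw [projIntegrand, weighted, mul_assoc, enorm_mul, mul_assoc, mul_assoc, ← ofReal_norm (_ * _),
      ← ENNReal.ofReal_mul (norm_nonneg _), ← ENNReal.ofReal_mul (by positivity), norm_mul,
      RCLike.norm_conj, Complex.norm_real, Real.norm_of_nonneg (by positivity)]
    congr 2
    have e1 : Real.exp (-‖v‖ ^ 2) = Real.exp (-‖v‖ ^ 2 / 2) * Real.exp (-‖v‖ ^ 2 / 2) := by
      rw [← Real.exp_add]; ring_nf
    have e2 : Real.exp (-(‖z‖ ^ 2 + ‖v‖ ^ 2) / 2) =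
        Real.exp (-‖z‖ ^ 2 / 2) * Real.exp (-‖v‖ ^ 2 / 2) := by
      rw [← Real.exp_add]; ring_nf
    rw [e1, e2]; ring
  rw [e, mul_left_comm (C.toNNReal : ℝ≥0∞)]
  refine mul_le_mul' le_rfl ?_
  exact (ENNReal.ofReal_le_ofReal (hC z v)).trans_eq (ENNReal.ofReal_mul hC0)

/-! ### Absolute convergence of the projection and the reproducing property. -/

/-- Combine `x^m ≤ m! e^x` with `(a + 1) x ≤ (a + 1)² + x²/4`. -/
theorem pow_mul_exp_le (m : ℕ) {a x : ℝ} (hx : 0 ≤ x) :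
    x ^ m * Real.exp (a * x - x ^ 2 / 2) ≤
      m.factorial * Real.exp ((a + 1) ^ 2) * Real.exp (-x ^ 2 / 4) := by
  have h1 : x ^ m ≤ m.factorial * Real.exp x := by
    have := Real.pow_div_factorial_le_exp x hx m
    rwa [div_le_iff₀' (by positivity)] at this
  calc x ^ m * Real.exp (a * x - x ^ 2 / 2)
      ≤ m.factorial * Real.exp x * Real.exp (a * x - x ^ 2 / 2) := by gcongr
    _ = m.factorial * Real.exp (x + (a * x - x ^ 2 / 2)) := by rw [Real.exp_add]; ring
    _ ≤ m.factorial * Real.exp ((a + 1) ^ 2 + -x ^ 2 / 4) := by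
        refine mul_le_mul_of_nonneg_left (Real.exp_le_exp.mpr ?_) (by positivity)
        nlinarith [sq_nonneg (a + 1 - x / 2)]
    _ = _ := by rw [Real.exp_add]; ring

/-- For convergence at a fixed `z` the crude bound `|K_z(v)| ≤ e^{|z||v|}` is enough; `a` plays the
role of `|z|`. -/
theorem enorm_mul_exp_le (m : ℕ) (a : ℝ) :
    ∃ C : ℝ≥0, ∀ (h : ℂ → ℂ) (v : ℂ),
      ‖h v‖ₑ * ENNReal.ofReal (‖v‖ ^ (2 * m) * Real.exp (-‖v‖ ^ 2) * Real.exp (a * ‖v‖)) ≤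
        C * (weighted m h v * ENNReal.ofReal (Real.exp (-‖v‖ ^ 2 / 4))) := by
  refine ⟨(m.factorial * Real.exp ((a + 1) ^ 2)).toNNReal, fun h v => ?_⟩
  rw [weighted, mul_assoc ‖h v‖ₑ, mul_left_comm (Real.toNNReal _ : ℝ≥0∞)]
  refine mul_le_mul' le_rfl ?_
  have h1 := pow_mul_exp_le m (a := a) (norm_nonneg v)
  have e : ‖v‖ ^ (2 * m) * Real.exp (-‖v‖ ^ 2) * Real.exp (a * ‖v‖) =
      ‖v‖ ^ m * Real.exp (-‖v‖ ^ 2 / 2) * (‖v‖ ^ m * Real.exp (a * ‖v‖ - ‖v‖ ^ 2 / 2)) := by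
    have : Real.exp (-‖v‖ ^ 2) * Real.exp (a * ‖v‖) =
        Real.exp (-‖v‖ ^ 2 / 2) * Real.exp (a * ‖v‖ - ‖v‖ ^ 2 / 2) := by
      rw [← Real.exp_add, ← Real.exp_add]; ring_nf
    rw [mul_assoc, this]; ring
  rw [e, ENNReal.ofReal_mul (by positivity), mul_left_comm]
  refine mul_le_mul' le_rfl ?_
  exact (ENNReal.ofReal_le_ofReal h1).trans_eq (ENNReal.ofReal_mul (by positivity))

theorem enorm_projIntegrand_le (m : ℕ) (h : ℂ → ℂ) (z v : ℂ) :
    ‖projIntegrand m h z v‖ₑ ≤ ‖h v‖ₑ *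
      ENNReal.ofReal (‖v‖ ^ (2 * m) * Real.exp (-‖v‖ ^ 2) * Real.exp (‖z‖ * ‖v‖)) := by
  rw [projIntegrand, mul_assoc, enorm_mul, ← ofReal_norm (_ * _), norm_mul,
    RCLike.norm_conj, Complex.norm_real, Real.norm_of_nonneg (by positivity), mul_comm ‖_‖]
  gcongr
  exact norm_kernel_le m z v

theorem lintegral_exp_neg_mul_sq_lt_top {b : ℝ} (hb : 0 < b) :
    ∫⁻ v : ℂ, ENNReal.ofReal (Real.exp (-b * ‖v‖ ^ 2)) < ∞ := by
  have h := GaussianFourier.integrable_cexp_neg_mul_sq_norm_add (V := ℂ) (b := b)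
    (by simpa using hb) 0 0
  have h2 := h.norm.lintegral_lt_top
  refine lt_of_le_of_lt (le_of_eq ?_) h2
  congr 1; ext v
  rw [Complex.norm_exp]
  congr 2
  norm_cast
  simp

theorem lintegral_mul_exp_lt_top {p : ℝ} (hp : 1 ≤ p) {φ : ℂ → ℝ≥0∞}
    (h : ∫⁻ v, φ v ^ p < ∞) {b : ℝ} (hb : 0 < b) :
    ∫⁻ v, φ v * ENNReal.ofReal (Real.exp (-b * ‖v‖ ^ 2)) < ∞ := by
  have hm : Measurable fun v : ℂ => ENNReal.ofReal (Real.exp (-b * ‖v‖ ^ 2)) :=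
    (Continuous.measurable (by fun_prop)).ennreal_ofReal
  -- The product is at most the Gaussian where `φ ≤ 1`, and at most `φ ^ p` where `φ ≥ 1`.
  refine lt_of_le_of_lt (lintegral_mono (g := fun v => ENNReal.ofReal (Real.exp (-b * ‖v‖ ^ 2)) +
    φ v ^ p) fun v => ?_) ?_
  · rcases le_total (φ v) 1 with h1 | h1
    · exact (mul_le_of_le_one_left' h1).trans le_self_add
    · refine le_trans (mul_le_of_le_one_right' ?_) ((ENNReal.le_rpow_self_of_one_le h1 hp).trans le_add_self)
      rw [ENNReal.ofReal_le_one, Real.exp_le_one_iff]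
      have := sq_nonneg ‖v‖
      nlinarith
  · rw [lintegral_add_left hm]
    exact ENNReal.add_lt_top.mpr ⟨lintegral_exp_neg_mul_sq_lt_top hb, h⟩

theorem aestronglyMeasurable_projIntegrand (m : ℕ) {h : ℂ → ℂ} (hh : AEStronglyMeasurable h) :
    AEStronglyMeasurable (Function.uncurry (projIntegrand m h))
      ((volume : Measure ℂ).prod volume) := by
  have h1 := hh.comp_quasiMeasurePreserving
    (Measure.quasiMeasurePreserving_snd (μ := (volume : Measure ℂ)) (ν := (volume : Measure ℂ)))
  have h2 : Measurable fun x : ℂ × ℂ => starRingEnd ℂ (kernel m x.1 x.2) :=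
    (Complex.continuous_conj.measurable).comp (measurable_kernel m)
  have h3 : Continuous fun x : ℂ × ℂ => ((‖x.2‖ ^ (2 * m) * Real.exp (-‖x.2‖ ^ 2) : ℝ) : ℂ) := by
    fun_prop
  exact (h1.mul h2.aestronglyMeasurable).mul h3.aestronglyMeasurable

theorem aestronglyMeasurable_projIntegrand_right (m : ℕ) {h : ℂ → ℂ}
    (hh : AEStronglyMeasurable h) (z : ℂ) : AEStronglyMeasurable (projIntegrand m h z) := by
  have h2 : Measurable fun v : ℂ => starRingEnd ℂ (kernel m z v) :=
    (Complex.continuous_conj.measurable).comp (measurable_kernel m).of_uncurry_left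
  have h3 : Continuous fun v : ℂ => ((‖v‖ ^ (2 * m) * Real.exp (-‖v‖ ^ 2) : ℝ) : ℂ) := by
    fun_prop
  exact (hh.mul h2.aestronglyMeasurable).mul h3.aestronglyMeasurable

theorem aestronglyMeasurable_proj (m : ℕ) {h : ℂ → ℂ} (hh : AEStronglyMeasurable h) :
    AEStronglyMeasurable (proj m h) :=
  (aestronglyMeasurable_projIntegrand m hh).integral_prod_right'.const_mul _

theorem integrable_norm_mul_exp {p : ℝ} (hp : 1 ≤ p) (m : ℕ) {f : ℂ → ℂ}
    (hf : AEStronglyMeasurable f) (h : ∫⁻ v, weighted m f v ^ p < ∞) (a : ℝ) :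
    Integrable fun v => ‖f v‖ * (‖v‖ ^ (2 * m) * Real.exp (-‖v‖ ^ 2) * Real.exp (a * ‖v‖)) := by
  obtain ⟨C, hC⟩ := enorm_mul_exp_le m a
  refine ⟨hf.norm.mul (Continuous.aestronglyMeasurable (by fun_prop)), ?_⟩
  have h1 := lintegral_mul_exp_lt_top hp h (b := 1 / 4) (by norm_num)
  have h2 := ENNReal.mul_lt_top (ENNReal.coe_lt_top (r := C)) h1
  rw [← lintegral_const_mul' _ _ ENNReal.coe_ne_top] at h2
  refine lt_of_le_of_lt (lintegral_mono fun v => le_trans (le_of_eq ?_) ((hC f v).trans_eq ?_)) h2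
  · rw [enorm_mul, enorm_norm, Real.enorm_of_nonneg (by positivity)]
  · congr 4; ring

theorem integral_pow_mul_gaussian (n : ℕ) :
    ∫ v : ℂ, ‖v‖ ^ (2 * n) * Real.exp (-‖v‖ ^ 2) = Real.pi * n.factorial := by
  have h := Complex.integral_rpow_mul_exp_neg_rpow (p := 2) (q := ((2 * n : ℕ) : ℝ)) (by norm_num)
    (lt_of_lt_of_le (by norm_num) (Nat.cast_nonneg _))
  simp only [Real.rpow_natCast, Real.rpow_two] at h
  rw [h, show (((2 * n : ℕ) : ℝ) + 2) / 2 = (n : ℝ) + 1 by push_cast; ring, Real.Gamma_nat_eq_factorial]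
  ring

/-- The kernel reproduces entire functions of Gaussian growth. -/
theorem proj_eq_self {p : ℝ} (hp : 1 ≤ p) (m : ℕ) {f : ℂ → ℂ} (hf : Differentiable ℂ f)
    (h : ∫⁻ v, weighted m f v ^ p < ∞) (z : ℂ) : proj m f z = f z := by
  have hfc : AEStronglyMeasurable f := hf.continuous.aestronglyMeasurable
  set ψ : ℝ → ℝ := fun x => x ^ (2 * m) * Real.exp (-x ^ 2) with hψ
  have hψm : Measurable ψ := Continuous.measurable (by fun_prop)
  have hψ0 : ∀ x, 0 ≤ ψ x := fun x => mul_nonneg (by rw [pow_mul]; positivity) (Real.exp_nonneg _)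
  set c : ℕ → ℂ := fun k => (m.factorial : ℂ) / ((k + m).factorial : ℂ) with hc
  set T : ℕ → ℂ → ℂ := fun k v => f v * (c k * (z * starRingEnd ℂ v) ^ k) * (ψ ‖v‖ : ℂ) with hT
  have hTsum : ∀ v, HasSum (fun k => T k v) (projIntegrand m f z v) := by
    intro v
    have h1 := ((Complex.hasSum_conj'.mpr (hasSum_kernel m z v)).mul_left (f v)).mul_right (ψ ‖v‖ : ℂ)
    refine h1.congr_fun fun k => ?_
    simp [hT, hc]
  have hbound : ∀ k v, ‖T k v‖ ≤ ‖f v‖ * ((‖z‖ * ‖v‖) ^ k / k.factorial) * ψ ‖v‖ := by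
    intro k v
    have h1 := norm_kernel_term_le m k (z * starRingEnd ℂ v)
    rw [norm_mul z, RCLike.norm_conj] at h1
    rw [hT]
    simp only
    rw [norm_mul, norm_mul (f v), Complex.norm_real, Real.norm_of_nonneg (hψ0 _)]
    gcongr
  have hbsum : ∀ v, HasSum (fun k : ℕ => ‖f v‖ * ((‖z‖ * ‖v‖) ^ k / k.factorial) * ψ ‖v‖)
      (‖f v‖ * Real.exp (‖z‖ * ‖v‖) * ψ ‖v‖) := by
    intro v
    refine (HasSum.mul_left _ ?_).mul_right _
    rw [Real.exp_eq_exp_ℝ]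
    exact NormedSpace.expSeries_div_hasSum_exp _
  have hmom : ∀ k, Integrable fun v : ℂ => f v * starRingEnd ℂ v ^ k * (ψ ‖v‖ : ℂ) := by
    intro k
    refine ((integrable_norm_mul_exp hp m hfc h 1).const_mul (k.factorial : ℝ)).mono' ?_ ?_
    · have := hf.continuous
      exact Continuous.aestronglyMeasurable (by fun_prop)
    · refine Filter.Eventually.of_forall fun v => ?_
      have h1 : ‖v‖ ^ k ≤ k.factorial * Real.exp ‖v‖ := by
        have := Real.pow_div_factorial_le_exp ‖v‖ (norm_nonneg v) k
        rwa [div_le_iff₀' (by positivity)] at this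
      rw [norm_mul, norm_mul, norm_pow, RCLike.norm_conj, Complex.norm_real,
        Real.norm_of_nonneg (hψ0 _), one_mul]
      calc ‖f v‖ * ‖v‖ ^ k * ψ ‖v‖ ≤ ‖f v‖ * (k.factorial * Real.exp ‖v‖) * ψ ‖v‖ := by
            gcongr
        _ = _ := by rw [hψ]; ring
  -- The radial moment `π (k + m)!` cancels the denominator of the kernel coefficient, leaving `π
  -- m!` times the `k`-th Taylor term of `f` at `z`.
  have hTint : ∀ k, ∫ v, T k v = (Real.pi * m.factorial : ℂ) *
      ((k.factorial : ℂ)⁻¹ • (z - 0) ^ k • iteratedDeriv k f 0) := by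
    intro k
    have e : T k = fun v => c k * z ^ k * (f v * starRingEnd ℂ v ^ k * (ψ ‖v‖ : ℂ)) := by
      ext v; simp only [hT, mul_pow]; ring
    have e2 : ∫ v : ℂ, ‖v‖ ^ (2 * k) * ψ ‖v‖ = Real.pi * (k + m).factorial := by
      rw [← integral_pow_mul_gaussian]
      congr 1; ext v
      rw [hψ, mul_add, pow_add]; ring
    rw [e, integral_const_mul, integral_mul_conj_pow_mul_radial hf k hψm (hmom k), e2]
    have h1 : ((k + m).factorial : ℂ) ≠ 0 := by exact_mod_cast (k + m).factorial_ne_zero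
    have h2 : (k.factorial : ℂ) ≠ 0 := by exact_mod_cast k.factorial_ne_zero
    simp only [hc, smul_eq_mul, sub_zero]
    push_cast
    field_simp
  have hsum := hasSum_integral_of_dominated_convergence (μ := volume) (F := T)
    (f := projIntegrand m f z)
    (fun (k : ℕ) v => ‖f v‖ * ((‖z‖ * ‖v‖) ^ k / k.factorial) * ψ ‖v‖)
    (fun k => by
      have := hf.continuous
      exact Continuous.aestronglyMeasurable (by fun_prop))
    (fun k => Filter.Eventually.of_forall (hbound k))
    (Filter.Eventually.of_forall fun v => (hbsum v).summable)
    (by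
      simp_rw [(hbsum _).tsum_eq]
      refine (integrable_norm_mul_exp hp m hfc h ‖z‖).congr
        (Filter.Eventually.of_forall fun v => ?_)
      simp only [hψ]; ring)
    (Filter.Eventually.of_forall hTsum)
  simp_rw [hTint] at hsum
  have h2 := hsum.unique ((Complex.hasSum_taylorSeries_of_entire hf 0 z).mul_left _)
  have hpi : (Real.pi : ℂ) ≠ 0 := by exact_mod_cast Real.pi_ne_zero
  have hm : (m.factorial : ℂ) ≠ 0 := by exact_mod_cast m.factorial_ne_zero
  rw [proj, h2]
  field_simp

/-! ### Functions of bounded mean oscillation and their disk averages. -/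

theorem aestronglyMeasurable_diskAverage (r : ℝ) {g : ℂ → ℂ} (hg : AEStronglyMeasurable g) :
    AEStronglyMeasurable (diskAverage r g) := by
  have hs : MeasurableSet {x : ℂ × ℂ | dist x.2 x.1 ≤ r} :=
    (isClosed_le (by fun_prop) continuous_const).measurableSet
  have h1 : AEStronglyMeasurable (fun x : ℂ × ℂ => g x.2) ((volume : Measure ℂ).prod volume) :=
    hg.comp_quasiMeasurePreserving Measure.quasiMeasurePreserving_snd
  have h2 := (h1.indicator hs).integral_prod_right'
  refine (h2.congr (Filter.Eventually.of_forall fun z => ?_)).const_mul _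
  simp only
  rw [← integral_indicator Metric.isClosed_closedBall.measurableSet]
  rfl

theorem diskAverage_conj (r : ℝ) (g : ℂ → ℂ) (z : ℂ) :
    diskAverage r (fun v => starRingEnd ℂ (g v)) z = starRingEnd ℂ (diskAverage r g z) := by
  rw [diskAverage, diskAverage, map_mul, integral_conj]
  simp

theorem conj_mem_bmo {p r : ℝ} {g : ℂ → ℂ} (hg : g ∈ bmo p r) :
    (fun v => starRingEnd ℂ (g v)) ∈ bmo p r := by
  have hc : ∀ x : ℂ, ‖starRingEnd ℂ x‖ₑ = ‖x‖ₑ := fun x => by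
    rw [← ofReal_norm, RCLike.norm_conj, ofReal_norm]
  obtain ⟨⟨h1, h2⟩, h3⟩ := hg
  refine ⟨⟨Complex.continuous_conj.comp_aestronglyMeasurable h1, fun K hK => ?_⟩, ?_⟩
  · exact (h2 K hK).star
  · simpa only [bmoNorm, diskAverage_conj, ← map_sub, hc] using h3

theorem exists_lintegral_oscillation_le {p r : ℝ} (hp : 1 ≤ p) (hr : 0 < r) {g : ℂ → ℂ}
    (hg : g ∈ bmo p r) : ∃ M : ℝ≥0, ∀ z : ℂ,
      ∫⁻ v in Metric.closedBall z r, ‖g v - diskAverage r g z‖ₑ ^ p ≤ M := by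
  have hp0 : 0 < p := by linarith
  have hN := hg.2
  set N := bmoNorm p r g
  have hc : ENNReal.ofReal (1 / (Real.pi * r ^ 2)) ≠ 0 := by
    have := Real.pi_pos
    simp only [ne_eq, ENNReal.ofReal_eq_zero, not_le]
    positivity
  have hM : (ENNReal.ofReal (1 / (Real.pi * r ^ 2)))⁻¹ * N ^ p ≠ ∞ :=
    ENNReal.mul_ne_top (ENNReal.inv_ne_top.mpr hc) (ENNReal.rpow_ne_top_of_nonneg hp0.le hN.ne)
  refine ⟨((ENNReal.ofReal (1 / (Real.pi * r ^ 2)))⁻¹ * N ^ p).toNNReal, fun z => ?_⟩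
  rw [ENNReal.coe_toNNReal hM]
  have h1 : (ENNReal.ofReal (1 / (Real.pi * r ^ 2)) *
    ∫⁻ v in Metric.closedBall z r, ‖g v - diskAverage r g z‖ₑ ^ p) ^ (1 / p) ≤ N :=
    le_iSup (fun z : ℂ => (ENNReal.ofReal (1 / (Real.pi * r ^ 2)) *
      ∫⁻ v in Metric.closedBall z r, ‖g v - diskAverage r g z‖ₑ ^ p) ^ (1 / p)) z
  rw [one_div p, ENNReal.rpow_inv_le_iff hp0] at h1
  refine le_trans (le_of_eq ?_) (mul_le_mul' le_rfl h1)
  rw [← mul_assoc, ENNReal.inv_mul_cancel hc ENNReal.ofReal_ne_top, one_mul]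

/-- Centred means over nearby discs differ by a bounded amount. -/
theorem exists_enorm_sub_le_of_dist_le {p r : ℝ} (hp : 1 ≤ p) (hr : 0 < r) {g a : ℂ → ℂ}
    (hg : AEStronglyMeasurable g) {M : ℝ≥0}
    (hM : ∀ z : ℂ, ∫⁻ v in Metric.closedBall z r, ‖g v - a z‖ₑ ^ p ≤ M) :
    ∃ L : ℝ≥0, ∀ z w : ℂ, dist z w ≤ r → ‖a z - a w‖ ≤ L := by
  have hp0 : 0 < p := by linarith
  set V := volume (Metric.closedBall (0 : ℂ) r) with hV
  have hVt : V ≠ ∞ := (isCompact_closedBall 0 r).measure_lt_top.ne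
  set M1 : ℝ≥0∞ := (V ^ (p - 1) * M) ^ (1 / p) with hM1
  have hM1t : M1 ≠ ∞ := ENNReal.rpow_ne_top_of_nonneg (by positivity)
    (ENNReal.mul_ne_top (ENNReal.rpow_ne_top_of_nonneg (by linarith) hVt) ENNReal.coe_ne_top)
  have hmean : ∀ z, ∫⁻ v in Metric.closedBall z r, ‖g v - a z‖ₑ ≤ M1 := by
    intro z
    rw [hM1, one_div, ENNReal.le_rpow_inv_iff hp0]
    refine (lintegral_rpow_le_measure_univ_mul _ hp
      (hg.sub aestronglyMeasurable_const).enorm.restrict).trans ?_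
    rw [Measure.restrict_apply_univ, hV, Complex.volume_closedBall, Complex.volume_closedBall]
    exact mul_le_mul' le_rfl (hM z)
  set S := volume (Metric.closedBall (0 : ℂ) (r / 2)) with hS
  have hS0 : S ≠ 0 := (Metric.measure_closedBall_pos _ _ (by linarith)).ne'
  have hSt : S ≠ ∞ := (isCompact_closedBall 0 _).measure_lt_top.ne
  have hLt : S⁻¹ * (M1 + M1) ≠ ∞ :=
    ENNReal.mul_ne_top (ENNReal.inv_ne_top.mpr hS0) (ENNReal.add_ne_top.mpr ⟨hM1t, hM1t⟩)
  refine ⟨(S⁻¹ * (M1 + M1)).toNNReal, fun z w hzw => ?_⟩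
  suffices h : ‖a z - a w‖ₑ ≤ ((S⁻¹ * (M1 + M1)).toNNReal : ℝ≥0∞) by
    rw [enorm_le_coe] at h
    exact h
  rw [ENNReal.coe_toNNReal hLt]
  -- The disk of radius `r / 2` about the midpoint lies in both disks of radius `r`; averaging `|a z
  -- - a w|` over it compares the two means through `g`.
  set c := midpoint ℝ z w with hc
  have hcz : Metric.closedBall c (r / 2) ⊆ Metric.closedBall z r := by
    refine Metric.closedBall_subset_closedBall' ?_
    rw [hc, dist_midpoint_left, Real.norm_of_nonneg (by norm_num)]
    linarith
  have hcw : Metric.closedBall c (r / 2) ⊆ Metric.closedBall w r := by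
    refine Metric.closedBall_subset_closedBall' ?_
    rw [hc, dist_midpoint_right, Real.norm_of_nonneg (by norm_num)]
    linarith
  have h1 : S * ‖a z - a w‖ₑ ≤ M1 + M1 := by
    calc S * ‖a z - a w‖ₑ = ∫⁻ _ in Metric.closedBall c (r / 2), ‖a z - a w‖ₑ := by
          rw [setLIntegral_const, mul_comm, hS, Complex.volume_closedBall,
            Complex.volume_closedBall]
      _ ≤ ∫⁻ v in Metric.closedBall c (r / 2), (‖g v - a z‖ₑ + ‖g v - a w‖ₑ) := by
          refine lintegral_mono fun v => ?_
          have e : a z - a w = (g v - a w) - (g v - a z) := by ring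
          rw [e, add_comm]
          exact enorm_sub_le
      _ = (∫⁻ v in Metric.closedBall c (r / 2), ‖g v - a z‖ₑ) +
            ∫⁻ v in Metric.closedBall c (r / 2), ‖g v - a w‖ₑ :=
          lintegral_add_left' (hg.sub aestronglyMeasurable_const).enorm.restrict _
      _ ≤ M1 + M1 := add_le_add ((lintegral_mono_set hcz).trans (hmean z))
          ((lintegral_mono_set hcw).trans (hmean w))
  calc ‖a z - a w‖ₑ = S⁻¹ * (S * ‖a z - a w‖ₑ) := by
        rw [← mul_assoc, ENNReal.inv_mul_cancel hS0 hSt, one_mul]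
    _ ≤ _ := mul_le_mul' le_rfl h1

/-- Chain along the segment from `w` to `z` in `⌈‖z - w‖ / r⌉` steps of length at most `r`. -/
theorem norm_sub_le_mul_of_local {r : ℝ} (hr : 0 < r) {a : ℂ → ℂ} {L : ℝ≥0}
    (h : ∀ z w : ℂ, dist z w ≤ r → ‖a z - a w‖ ≤ L) (z w : ℂ) :
    ‖a z - a w‖ ≤ L * (‖z - w‖ / r + 1) := by
  have key : ∀ n : ℕ, ∀ z w : ℂ, ‖z - w‖ ≤ n * r → ‖a z - a w‖ ≤ n * L := by
    intro n
    induction n with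
    | zero =>
      intro z w hzw
      have : z - w = 0 := norm_le_zero_iff.mp (by simpa using hzw)
      rw [sub_eq_zero.mp this]; simp
    | succ n ih =>
      intro z w hzw
      push_cast at hzw ⊢
      have hn : (0 : ℝ) < n + 1 := by positivity
      have hnc : ((n : ℂ) + 1) ≠ 0 := by exact_mod_cast hn.ne'
      have hnn : ‖(n : ℂ) + 1‖ = n + 1 := by
        exact_mod_cast Complex.norm_natCast (n + 1)
      set u : ℂ := w + n / (n + 1) * (z - w) with hu
      have h1 : ‖u - w‖ ≤ n * r := by
        have : u - w = n / (n + 1) * (z - w) := by rw [hu]; ring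
        rw [this, norm_mul, norm_div, hnn, Complex.norm_natCast, div_mul_eq_mul_div,
          div_le_iff₀ hn, mul_assoc]
        gcongr
        linarith
      have h2 : dist z u ≤ r := by
        have : z - u = (z - w) / (n + 1) := by rw [hu]; field_simp; ring
        rw [dist_eq_norm, this, norm_div, hnn, div_le_iff₀ hn]
        linarith
      have := norm_sub_le_norm_sub_add_norm_sub (a z) (a u) (a w)
      have := h z u h2
      have := ih u w h1
      linarith
  have h1 := key ⌈‖z - w‖ / r⌉₊ z w (by
    rw [← div_le_iff₀ hr]
    exact Nat.le_ceil _)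
  refine h1.trans ?_
  rw [mul_comm]
  gcongr
  exact (Nat.ceil_lt_add_one (by positivity)).le

/-- A function of bounded mean oscillation deviates from its means by a locally `p`-integrable
amount, up to a factor of slow growth. -/
theorem exists_bmo_bounds {p r : ℝ} (hp : 1 ≤ p) (hr : 0 < r) {g : ℂ → ℂ} (hg : g ∈ bmo p r) :
    ∃ L M : ℝ≥0,
      (∀ z v : ℂ, ‖diskAverage r g z - g v‖ₑ ≤ L * ((1 + ‖g v - diskAverage r g v‖ₑ) *
        ENNReal.ofReal (Real.exp (‖z - v‖ ^ 2 / 16)))) ∧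
      ∀ z : ℂ, ∫⁻ v in Metric.closedBall z r, (1 + ‖g v - diskAverage r g v‖ₑ) ^ p ≤ M := by
  have hp0 : 0 < p := by linarith
  set a := diskAverage r g with ha
  have hgm : AEStronglyMeasurable g := hg.1.1
  obtain ⟨M, hM⟩ := exists_lintegral_oscillation_le hp hr hg
  obtain ⟨L, hL⟩ := exists_enorm_sub_le_of_dist_le hp hr hgm hM
  have hG := norm_sub_le_mul_of_local hr hL
  set V := volume (Metric.closedBall (0 : ℂ) r) with hV
  have hVt : V ≠ ∞ := (isCompact_closedBall 0 r).measure_lt_top.ne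
  have h2t : (2 : ℝ≥0∞) ^ (p - 1) ≠ ∞ := ENNReal.rpow_ne_top_of_nonneg (by linarith) (by simp)
  have hQt : (2 : ℝ≥0∞) ^ (p - 1) * (M + (1 + L) ^ p * V) ≠ ∞ := by
    refine ENNReal.mul_ne_top h2t (ENNReal.add_ne_top.mpr ⟨ENNReal.coe_ne_top,
      ENNReal.mul_ne_top (ENNReal.rpow_ne_top_of_nonneg hp0.le (by simp)) hVt⟩)
  refine ⟨1 + L * (4 / r + 1).toNNReal, ((2 : ℝ≥0∞) ^ (p - 1) * (M + (1 + L) ^ p * V)).toNNReal,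
    fun z v => ?_, fun z => ?_⟩
  -- The rate `1/16` is half of the kernel's `1/8`, so Gaussian decay survives in the product. It
  -- absorbs the linear growth of `a` through `‖z - v‖ ≤ 4 E`, where `4` is not sharp.
  · set E := Real.exp (‖z - v‖ ^ 2 / 16) with hE
    have hE1 : 1 ≤ E := Real.one_le_exp (by positivity)
    have hx : ‖z - v‖ ≤ 4 * E := by
      have := Real.add_one_le_exp (‖z - v‖ ^ 2 / 16)
      nlinarith [sq_nonneg (‖z - v‖ / 4 - 1)]
    have h1 : ‖a z - a v‖ ≤ L * (4 / r + 1) * E := by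
      refine (hG z v).trans ?_
      rw [mul_assoc]
      gcongr
      rw [add_mul, one_mul]
      gcongr
      rw [div_mul_eq_mul_div]
      gcongr
    have h2 : ‖a z - a v‖ₑ ≤ (L * (4 / r + 1).toNNReal : ℝ≥0) * ENNReal.ofReal E := by
      rw [← ofReal_norm]
      refine (ENNReal.ofReal_le_ofReal h1).trans_eq ?_
      rw [ENNReal.ofReal_mul (by positivity), ENNReal.ofReal_mul (by positivity),
        ENNReal.ofReal_coe_nnreal, ENNReal.coe_mul]
      rfl
    have hE1' : 1 ≤ ENNReal.ofReal E := by
      rw [← ENNReal.ofReal_one]; exact ENNReal.ofReal_le_ofReal hE1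
    have e : a z - g v = (a z - a v) - (g v - a v) := by ring
    rw [e]
    refine (enorm_sub_le (E := ℂ)).trans ?_
    calc ‖a z - a v‖ₑ + ‖g v - a v‖ₑ
        ≤ (L * (4 / r + 1).toNNReal : ℝ≥0) * ENNReal.ofReal E * (1 + ‖g v - a v‖ₑ) +
          1 * ENNReal.ofReal E * (1 + ‖g v - a v‖ₑ) := by
          gcongr
          · exact h2.trans (le_mul_of_one_le_right' le_self_add)
          · rw [one_mul]
            exact le_add_self.trans (le_mul_of_one_le_left' hE1')
      _ = _ := by push_cast; ring
  · rw [ENNReal.coe_toNNReal hQt]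
    have hm : AEMeasurable (fun v => ‖g v - a z‖ₑ ^ p) :=
      (hgm.sub aestronglyMeasurable_const).enorm.pow_const p
    calc ∫⁻ v in Metric.closedBall z r, (1 + ‖g v - a v‖ₑ) ^ p
        -- On the disk about `z`, replacing the moving mean `a v` by the fixed `a z` costs at most
        -- `L`.
        ≤ ∫⁻ v in Metric.closedBall z r, 2 ^ (p - 1) * (‖g v - a z‖ₑ ^ p + (1 + L) ^ p) := by
          refine setLIntegral_mono' Metric.isClosed_closedBall.measurableSet fun v hv => ?_
          refine le_trans (ENNReal.rpow_le_rpow ?_ hp0.le)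
            (ENNReal.rpow_add_le_mul_rpow_add_rpow _ _ hp)
          have e : g v - a v = (g v - a z) + (a z - a v) := by ring
          have h1 : ‖a z - a v‖ₑ ≤ L := by
            rw [enorm_le_coe]
            exact hL z v (by rw [dist_comm]; exact hv)
          calc 1 + ‖g v - a v‖ₑ ≤ 1 + (‖g v - a z‖ₑ + L) := by
                rw [e]
                gcongr
                exact (enorm_add_le _ _).trans (by gcongr)
            _ = _ := by ring
      _ = 2 ^ (p - 1) * ((∫⁻ v in Metric.closedBall z r, ‖g v - a z‖ₑ ^ p) + (1 + L) ^ p * V) := by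
          rw [lintegral_const_mul' _ _ h2t, lintegral_add_left' hm.restrict, setLIntegral_const,
            hV, Complex.volume_closedBall, Complex.volume_closedBall]
      _ ≤ _ := by gcongr; exact hM z

/-! ### Estimates for the Hankel operator. -/

theorem weighted_mul (m : ℕ) (u f : ℂ → ℂ) (v : ℂ) :
    weighted m (fun v => u v * f v) v = ‖u v‖ₑ * weighted m f v := by
  rw [weighted, weighted, enorm_mul, mul_assoc]

theorem integrable_projIntegrand_mul {p : ℝ} (hp : 1 ≤ p) (m : ℕ) {g f : ℂ → ℂ} {B : ℂ → ℝ≥0∞}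
    {L : ℝ≥0∞} (hL : L ≠ ∞) (hg : AEStronglyMeasurable g) (hf : AEStronglyMeasurable f)
    (hgB : ∀ v, ‖g v‖ₑ ≤ L * (B v * ENNReal.ofReal (Real.exp (‖v‖ ^ 2 / 16))))
    (hBf : ∫⁻ v, (B v * weighted m f v) ^ p < ∞) (z : ℂ) :
    Integrable (projIntegrand m (fun v => g v * f v) z) := by
  refine ⟨aestronglyMeasurable_projIntegrand_right m (hg.mul hf) z, ?_⟩
  obtain ⟨C, hC⟩ := enorm_mul_exp_le m ‖z‖
  -- The rate is `3/16 = 1/4 - 1/16`: Gaussian decay minus the growth allowed to the symbol.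
  have h1 := ENNReal.mul_lt_top (ENNReal.mul_lt_top (ENNReal.coe_lt_top (r := C)) hL.lt_top)
    (lintegral_mul_exp_lt_top hp hBf (b := 3 / 16) (by norm_num))
  rw [← lintegral_const_mul' _ _ (ENNReal.mul_ne_top ENNReal.coe_ne_top hL)] at h1
  refine lt_of_le_of_lt (lintegral_mono fun v => ?_) h1
  refine (enorm_projIntegrand_le m _ z v).trans ((hC (fun v => g v * f v) v).trans ?_)
  rw [weighted_mul, mul_assoc (C : ℝ≥0∞)]
  refine mul_le_mul' le_rfl ?_
  have e : Real.exp (-(3 / 16) * ‖v‖ ^ 2) =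
      Real.exp (‖v‖ ^ 2 / 16) * Real.exp (-‖v‖ ^ 2 / 4) := by
    rw [← Real.exp_add]; ring_nf
  rw [e, ENNReal.ofReal_mul (by positivity)]
  calc _ ≤ L * (B v * ENNReal.ofReal (Real.exp (‖v‖ ^ 2 / 16))) * weighted m f v *
        ENNReal.ofReal (Real.exp (-‖v‖ ^ 2 / 4)) := by
        gcongr
        exact hgB v
    _ = _ := by ring

/-- Constant symbols give the zero Hankel operator on functions that `P^m` reproduces. The identity
is pointwise, so `c` may vary with `z`. -/
theorem hankel_eq {m : ℕ} {g f : ℂ → ℂ} {z : ℂ} (hrep : proj m f z = f z)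
    (hf : Integrable (projIntegrand m f z))
    (hgf : Integrable (projIntegrand m (fun v => g v * f v) z)) (c : ℂ) :
    hankel m g f z = (g z - c) * f z + proj m (fun v => (c - g v) * f v) z := by
  have h : proj m (fun v => (c - g v) * f v) z =
      c * proj m f z - proj m (fun v => g v * f v) z := by
    have e : projIntegrand m (fun v => (c - g v) * f v) z = fun v =>
        c * projIntegrand m f z v - projIntegrand m (fun v => g v * f v) z v := by
      ext v; simp only [projIntegrand]; ring
    rw [proj, e, integral_sub (hf.const_mul c) hgf, integral_const_mul, proj, proj]
    ring
  rw [h, hrep, hankel]; ring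

/-- The weighted modulus of the Hankel operator is dominated by a Gaussian convolution. -/
theorem exists_weighted_hankel_le (m : ℕ) (L : ℝ≥0) :
    ∃ K : ℝ≥0, ∀ (g a f : ℂ → ℂ) (B : ℂ → ℝ≥0∞),
      (∀ z v, ‖a z - g v‖ₑ ≤ L * (B v * ENNReal.ofReal (Real.exp (‖z - v‖ ^ 2 / 16)))) →
      (∀ v, ‖g v - a v‖ₑ ≤ B v) →
      (∀ z, proj m f z = f z) → (∀ z, Integrable (projIntegrand m f z)) →
      (∀ z, Integrable (projIntegrand m (fun v => g v * f v) z)) →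
      ∀ z, weighted m (hankel m g f) z ≤ B z * weighted m f z + K *
        ∫⁻ v, B v * weighted m f v * ENNReal.ofReal (Real.exp (-(1 / 16) * ‖z - v‖ ^ 2)) := by
  obtain ⟨C, hC⟩ := enorm_projIntegrand_mul_le m
  refine ⟨‖(1 / ((Real.pi : ℂ) * (m.factorial : ℂ)))‖₊ * (C * L),
    fun g a f B hosc hB hrep hf hgf z => ?_⟩
  set W := ENNReal.ofReal (‖z‖ ^ m * Real.exp (-‖z‖ ^ 2 / 2)) with hW
  have hWt : W ≠ ∞ := ENNReal.ofReal_ne_top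
  have h1 : ‖proj m (fun v => (a z - g v) * f v) z‖ₑ * W ≤
      ‖(1 / ((Real.pi : ℂ) * (m.factorial : ℂ)))‖ₑ * (C * L *
        ∫⁻ v, B v * weighted m f v * ENNReal.ofReal (Real.exp (-(1 / 16) * ‖z - v‖ ^ 2))) := by
    rw [proj, enorm_mul, mul_assoc]
    refine mul_le_mul' le_rfl ?_
    refine (mul_le_mul' (enorm_integral_le_lintegral_enorm _) le_rfl).trans ?_
    rw [← lintegral_mul_const' _ _ hWt,
      ← lintegral_const_mul' _ _ (ENNReal.mul_ne_top ENNReal.coe_ne_top ENNReal.coe_ne_top)]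
    refine lintegral_mono fun v => (hC _ z v).trans ?_
    rw [weighted_mul m (fun v => a z - g v), mul_assoc (C : ℝ≥0∞)]
    refine mul_le_mul' le_rfl ?_
    have e : Real.exp (-(1 / 16) * ‖z - v‖ ^ 2) =
        Real.exp (‖z - v‖ ^ 2 / 16) * Real.exp (-‖z - v‖ ^ 2 / 8) := by
      rw [← Real.exp_add]; ring_nf
    rw [e, ENNReal.ofReal_mul (by positivity)]
    calc _ ≤ L * (B v * ENNReal.ofReal (Real.exp (‖z - v‖ ^ 2 / 16))) * weighted m f v *
          ENNReal.ofReal (Real.exp (-‖z - v‖ ^ 2 / 8)) := by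
          gcongr
          exact hosc z v
      _ = _ := by ring
  -- The constant subtracted at `z` is the local mean `a z`.
  rw [weighted, hankel_eq (hrep z) (hf z) (hgf z) (a z), ← hW]
  calc _ ≤ (‖(g z - a z) * f z‖ₑ + ‖proj m (fun v => (a z - g v) * f v) z‖ₑ) * W := by
        gcongr
        exact enorm_add_le _ _
    _ = ‖g z - a z‖ₑ * weighted m f z + ‖proj m (fun v => (a z - g v) * f v) z‖ₑ * W := by
        rw [add_mul, enorm_mul, mul_assoc, weighted]
    _ ≤ _ := by
        refine add_le_add (mul_le_mul' (hB z) le_rfl) (h1.trans_eq ?_)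
        · rw [ENNReal.coe_mul, ENNReal.coe_mul, mul_assoc _ (_ * _) (lintegral _ _)]
          rfl

theorem hankelBounded_of_mem_bmo (m : ℕ) {p r : ℝ} (hp : 1 ≤ p) (hr : 0 < r) {g : ℂ → ℂ}
    (hg : g ∈ bmo p r) : HankelBounded p m g := by
  have hp0 : 0 < p := by linarith
  have hgm : AEStronglyMeasurable g := hg.1.1
  set a := diskAverage r g with ha
  have ham : AEStronglyMeasurable a := aestronglyMeasurable_diskAverage r hgm
  -- The summand `1` lets `B` also dominate constants, such as differences of means and `|a 0|`.
  set B : ℂ → ℝ≥0∞ := fun v => 1 + ‖g v - a v‖ₑ with hB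
  have hBm : AEMeasurable B := (hgm.sub ham).enorm.const_add 1
  obtain ⟨L, M, hosc, hM⟩ := exists_bmo_bounds hp hr hg
  obtain ⟨C₀, hloc⟩ := weighted_le_setLIntegral m hr
  obtain ⟨C₁, hC₁⟩ := lintegral_mul_rpow_le_of_local hp r M C₀ hBm hM
  obtain ⟨K, hK⟩ := exists_weighted_hankel_le m L
  have hFm : ∀ f ∈ fockSobolev p m, AEMeasurable (weighted m f) := fun f hf =>
    aemeasurable_weighted m hf.1.continuous.aestronglyMeasurable
  have hBF : ∀ f ∈ fockSobolev p m,
      ∫⁻ v, (B v * weighted m f v) ^ p ≤ C₁ * ∫⁻ v, weighted m f v ^ p := fun f hf =>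
    hC₁ _ (hFm f hf) (hloc f hf.1)
  have hFt : ∀ f ∈ fockSobolev p m, ∫⁻ v, weighted m f v ^ p < ∞ := fun f hf =>
    lintegral_weighted_rpow_lt_top_of_mem hp hf
  have hint : ∀ f ∈ fockSobolev p m, ∀ z,
      Integrable (projIntegrand m (fun v => g v * f v) z) := by
    intro f hf z
    refine integrable_projIntegrand_mul hp m (L := ‖a 0‖ₑ + L) (B := B) (by simp) hgm
      hf.1.continuous.aestronglyMeasurable (fun v => ?_)
      ((hBF f hf).trans_lt (ENNReal.mul_lt_top ENNReal.coe_lt_top (hFt f hf))) z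
    have h1 := hosc 0 v
    rw [zero_sub, norm_neg] at h1
    have h2 : 1 ≤ B v * ENNReal.ofReal (Real.exp (‖v‖ ^ 2 / 16)) := by
      refine one_le_mul_of_one_le_of_one_le le_self_add ?_
      rw [← ENNReal.ofReal_one]
      exact ENNReal.ofReal_le_ofReal (Real.one_le_exp (by positivity))
    rw [add_mul]
    calc ‖g v‖ₑ = ‖a 0 - (a 0 - g v)‖ₑ := by rw [sub_sub_cancel]
      _ ≤ ‖a 0‖ₑ + ‖a 0 - g v‖ₑ := enorm_sub_le
      _ ≤ _ := add_le_add (le_mul_of_one_le_right' h2) h1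
  have hint1 : ∀ f ∈ fockSobolev p m, ∀ z, Integrable (projIntegrand m f z) := by
    intro f hf z
    -- Integrability for `f` itself is the case of the constant symbol `1`.
    have := integrable_projIntegrand_mul hp m (g := fun _ => 1) (f := f) (L := 1)
      (B := fun _ => 1) (by simp) aestronglyMeasurable_const
      hf.1.continuous.aestronglyMeasurable (fun v => ?_) (by simpa using hFt f hf) z
    · simpa using this
    · rw [enorm_one, one_mul, one_mul, ← ENNReal.ofReal_one]
      exact ENNReal.ofReal_le_ofReal (Real.one_le_exp (by positivity))
  set κ : ℂ → ℝ≥0∞ := fun w => ENNReal.ofReal (Real.exp (-(1 / 16) * ‖w‖ ^ 2)) with hκ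
  have hκm : Measurable κ := (Continuous.measurable (by fun_prop)).ennreal_ofReal
  have hκt : ∫⁻ w, κ w ≠ ∞ := (lintegral_exp_neg_mul_sq_lt_top (by norm_num)).ne
  -- Here `2 ^ (p - 1)` comes from `(x + y)^p ≤ 2^{p-1} (x^p + y^p)`, `C₁` from the Carleson
  -- embedding, and `(∫ κ)^p` from Young's inequality.
  set D : ℝ≥0∞ := 2 ^ (p - 1) * (C₁ + K ^ p * ((∫⁻ w, κ w) ^ p * C₁)) with hD
  have h2t : (2 : ℝ≥0∞) ^ (p - 1) ≠ ∞ := ENNReal.rpow_ne_top_of_nonneg (by linarith) (by simp)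
  have hKt : (K : ℝ≥0∞) ^ p ≠ ∞ := ENNReal.rpow_ne_top_of_nonneg hp0.le ENNReal.coe_ne_top
  have hDt : D ≠ ∞ := by
    refine ENNReal.mul_ne_top h2t (ENNReal.add_ne_top.mpr ⟨ENNReal.coe_ne_top,
      ENNReal.mul_ne_top hKt (ENNReal.mul_ne_top (ENNReal.rpow_ne_top_of_nonneg hp0.le hκt)
        ENNReal.coe_ne_top)⟩)
  have hmain : ∀ f ∈ fockSobolev p m, ∫⁻ z, weighted m (hankel m g f) z ^ p ≤
      D.toNNReal * ∫⁻ v, weighted m f v ^ p := by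
    intro f hf
    have hφm : AEMeasurable fun v => B v * weighted m f v := hBm.mul (hFm f hf)
    have hpt := hK g a f B hosc (fun v => le_add_self)
      (proj_eq_self hp m hf.1 (hFt f hf)) (hint1 f hf) (hint f hf)
    rw [ENNReal.coe_toNNReal hDt]
    calc ∫⁻ z, weighted m (hankel m g f) z ^ p
        ≤ ∫⁻ z, 2 ^ (p - 1) * ((B z * weighted m f z) ^ p +
            K ^ p * (∫⁻ v, B v * weighted m f v * κ (z - v)) ^ p) := by
          refine lintegral_mono fun z => (ENNReal.rpow_le_rpow (hpt z) hp0.le).trans ?_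
          rw [← ENNReal.mul_rpow_of_nonneg _ _ hp0.le]
          exact ENNReal.rpow_add_le_mul_rpow_add_rpow _ _ hp
      _ = 2 ^ (p - 1) * ((∫⁻ z, (B z * weighted m f z) ^ p) +
            K ^ p * ∫⁻ z, (∫⁻ v, B v * weighted m f v * κ (z - v)) ^ p) := by
          rw [lintegral_const_mul' _ _ h2t, lintegral_add_left' (hφm.pow_const p),
            lintegral_const_mul' _ _ hKt]
      _ ≤ 2 ^ (p - 1) * (C₁ * (∫⁻ v, weighted m f v ^ p) +
            K ^ p * ((∫⁻ w, κ w) ^ p * (C₁ * ∫⁻ v, weighted m f v ^ p))) := by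
          gcongr
          · exact hBF f hf
          · exact (lintegral_convolution_rpow_le hp hφm hκm).trans (mul_le_mul' le_rfl (hBF f hf))
      _ = D * ∫⁻ v, weighted m f v ^ p := by rw [hD]; ring
  refine ⟨hint, fun f hf => mem_lebesguePM hp m ?_ ?_, D.toNNReal ^ (1 / p), fun f hf =>
    normPM_le_of_lintegral_le hp m (hmain f hf)⟩
  · have hgf := hgm.mul (hf.1.continuous.aestronglyMeasurable (μ := (volume : Measure ℂ)))
    exact hgf.sub (aestronglyMeasurable_proj m hgf)
  · exact (hmain f hf).trans_lt (ENNReal.mul_lt_top ENNReal.coe_lt_top (hFt f hf))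

end FockSobolev

theorem mainTheorem1 (m : ℕ) (p r : ℝ) (hp : 1 ≤ p) (hr : 0 < r)
    (g : ℂ → ℂ) (hg : g ∈ FockSobolev.bmo p r) :
    FockSobolev.HankelBounded p m g ∧
      FockSobolev.HankelBounded p m (fun v => starRingEnd ℂ (g v)) :=
  ⟨FockSobolev.hankelBounded_of_mem_bmo m hp hr hg,
    FockSobolev.hankelBounded_of_mem_bmo m hp hr (FockSobolev.conj_mem_bmo hg)⟩
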